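/- A polynomial $p\in\mathbb R[x_1,\dots,x_m]$ is called $(d,C)$-bounded if its total degree is at most $d$ and, for every monomial of $p$ of total degree $d'$, the coefficient of that monomial has magnitude at most $C/(d')!$. It is called a $(k,d,C)$-bounded sum-of-squares polynomial if $p=q_1^2+\dots+q_k^2$ for some $(d,C)$-bounded polynomials $q_1,\dots,q_k\in\mathbb R[x_1,\dots,x_m]$. There is an absolute constant $\varepsilon_0>0$ such that the following holds for all $\varepsilon\in(0,\varepsilon_0)$ and all real $\beta\ge 1$. Call a univariate polynomial $P\in\mathbb R[x]$ *good* if it has degree at most $10^9\beta^2\log\frac1\varepsilon$ and satisfies: 1. $|P(x)-e^{-x}|\le\varepsilon$ for all $x\in[-\beta\log\frac1\varepsilon,\ \beta\log\frac1\varepsilon]$, and $|P(x)|\le\max(1,e^{-x})\,e^{|x|/\beta}$ for all $x\in\mathbb R$; 2. $P(x)>0$ and $99P(x)>|P'(x)|$ for all $x\in\mathbb R$; 3. the leading coefficients of $99P+P'$ and of $99P-P'$ are positive and at most $1$, and all complex roots of $99P+P'$ and of $99P-P'$ have magnitude at most $e^{10^{14}\beta^3\log^2(1/\varepsilon)}$.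 Then a good polynomial exists. Moreover, for every good polynomial $P$, with $d=\deg P$, and every polynomial $U$ with $U'=P$, the polynomial $$R(x,y)=0.5\,(x-y)\bigl(1+0.25(x-y)^2\bigr)\bigl(U(x)-U(y)\bigr)-0.00025\,(x-y)^2P(x)$$ is a $\bigl(6d^2,\ d,\ e^{10^{23}\beta^5\log^3(1/\varepsilon)}\bigr)$-bounded sum-of-squares polynomial in $x$ and $y$. -/

import Mathlib

open Polynomial

/-- `P` is a `(κ, η, ε)`-flat exponential approximation. -/
structure IsFlatExpApprox (κ η ε : ℝ) (P : ℝ[X]) : Prop where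
  approx : ∀ x ∈ Set.Icc (-κ) κ, |P.eval x - Real.exp (-x)| ≤ ε
  growth : ∀ x : ℝ, |P.eval x| ≤ max 1 (Real.exp (-x)) * Real.exp (η * |x|)

/-- The leading coefficient of `p` lies in `(0, 1]` and all complex roots of `p` have modulus
at most `A`. -/
structure HasLeadingCoeffAndRootsBound (A : ℝ) (p : ℝ[X]) : Prop where
  leadingCoeff_pos : 0 < p.leadingCoeff
  leadingCoeff_le_one : p.leadingCoeff ≤ 1
  roots_le : ∀ z : ℂ, aeval z p = 0 → ‖z‖ ≤ A

/-- The properties of the flat approximation to `e^{-x}` with parameters `β` and `ε`. -/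
structure IsGoodFlatPolynomial (β ε : ℝ) (P : ℝ[X]) : Prop where
  natDegree_le : (P.natDegree : ℝ) ≤ 10 ^ 9 * β ^ 2 * Real.log (1 / ε)
  flat : IsFlatExpApprox (β * Real.log (1 / ε)) (1 / β) ε P
  pos : ∀ x : ℝ, 0 < P.eval x
  deriv_lt : ∀ x : ℝ, |P.derivative.eval x| < 99 * P.eval x
  bound_add : HasLeadingCoeffAndRootsBound
    (Real.exp (10 ^ 14 * β ^ 3 * Real.log (1 / ε) ^ 2)) (C 99 * P + P.derivative)
  bound_sub : HasLeadingCoeffAndRootsBound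
    (Real.exp (10 ^ 14 * β ^ 3 * Real.log (1 / ε) ^ 2)) (C 99 * P - P.derivative)

/-- `p` is `(d, B)`-bounded: its total degree is at most `d` and the coefficient of each of its
monomials of total degree `d'` has magnitude at most `B / d'!`. -/
structure IsBoundedPolynomial {σ : Type*} (d : ℕ) (B : ℝ) (p : MvPolynomial σ ℝ) : Prop where
  totalDegree_le : p.totalDegree ≤ d
  abs_coeff_le : ∀ m ∈ p.support, |p.coeff m| ≤ B / (Nat.factorial m.degree : ℝ)

/-- `p` is a `(k, d, B)`-bounded sum-of-squares polynomial: `p = q₁² + ⋯ + q_k²` with each `q_i`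
being `(d, B)`-bounded. -/
def IsBoundedSOS {σ : Type*} (k d : ℕ) (B : ℝ) (p : MvPolynomial σ ℝ) : Prop :=
  ∃ q : Fin k → MvPolynomial σ ℝ, (∀ i, IsBoundedPolynomial d B (q i)) ∧ p = ∑ i, q i ^ 2

/-- The polynomial
`0.5 (x - y) (1 + 0.25 (x - y)²) (U(x) - U(y)) - 0.00025 (x - y)² P(x)` in the two variables
`x = X 0` and `y = X 1`. -/
noncomputable def sosTarget (P U : ℝ[X]) : MvPolynomial (Fin 2) ℝ :=
  let x : MvPolynomial (Fin 2) ℝ := MvPolynomial.X 0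
  let y : MvPolynomial (Fin 2) ℝ := MvPolynomial.X 1
  MvPolynomial.C 0.5 * (x - y) * (1 + MvPolynomial.C 0.25 * (x - y) ^ 2) * (aeval x U - aeval y U)
    - MvPolynomial.C 0.00025 * (x - y) ^ 2 * aeval x P

/-! Existence. Put L = log(1/ε). If D is the difference of two independent Poisson variables of mean
lam/2, then E e^{Dz} = e^{lam(cosh z - 1)}, so e^{lam(w-1)} = E T_D(w) for w ≥ -1
(`hasSum_poissonPair_T`). Keeping only |D| ≤ n leaves a polynomial (`truncExp`) whose error is a
Chernoff tail. An affine substitution turns it into q = `halfExp`, close to e^{-x/2} on a window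
from -βL to about 1000βn; to the left of the window q is nonnegative and |q'| ≤ 4q. The good
polynomial is P = (1-4σ)q² + σS, with S the Taylor polynomial of cosh(x/2β) of degree 2(n+1) and σ
tiny. The square gives the approximation without losing positivity. S dominates q² and qq' to the
right of the window and alone produces the leading coefficient; the factor 1-4σ makes room for S in
the growth bound. The roots are bounded by Cauchy's bound and crude coefficient estimates.

Sums of squares. Write u = x-y and z = x + s(y-x). The fundamental theorem of calculus and an
integration by parts give R = u² ∫₀¹ [(0.49975 + 0.125u²)P(z) - 0.00025(1-s)uP'(z)] ds. Substituting
P = (F+G)/198 and P' = (F-G)/2, where F = 99P+P' and G = 99P-P', attaches to F and to G a quadratic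
in u that is a nonnegative combination of three squares (`sum_quad`, `eval_sosTarget`). F and G are
positive, hence sums of two squares with coefficients controlled by the root bound
(`exists_sum_two_sq_of_pos`). Thus R is an integral over s of weighted squares of polynomials in s
of degree at most h = d/2, and factoring the Gram matrix of moments replaces each integral by h+1
squares (`exists_integral_sq_eq_sum_sq`). All coefficients are then estimated crudely inside one
exponential. -/

namespace Polynomial.Chebyshev

/-! ### Derivative and growth bounds for Chebyshev polynomials. -/

/-- The derivative is extremal at the endpoint 1, where its value is m². This polynomial growth in m
allows the Chebyshev series to be differentiated termwise. -/
lemma abs_derivative_T_eval_le (m : ℤ) {w : ℝ} (hw : |w| ≤ 1) :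
    |(derivative (T ℝ m)).eval w| ≤ (m : ℝ) ^ 2 := by
  have h := abs_iterate_derivative_T_real_le m 1 hw
  simpa [derivative_T_eval_one] using h

lemma eval_T_mono {w v : ℝ} (m : ℤ) (hw : 1 ≤ w) (hv : w ≤ v) :
    (T ℝ m).eval w ≤ (T ℝ m).eval v := by
  rw [← Real.cosh_arcosh hw, ← Real.cosh_arcosh (hw.trans hv), T_real_cosh, T_real_cosh,
    Real.cosh_le_cosh, abs_mul, abs_mul]
  refine mul_le_mul_of_nonneg_left ?_ (abs_nonneg _)
  rw [abs_of_nonneg (Real.arcosh_nonneg hw), abs_of_nonneg (Real.arcosh_nonneg (hw.trans hv))]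
  exact (Real.arcosh_le_arcosh (by linarith) (by linarith)).2 hv

lemma eval_U_nonneg_and_mono {w v : ℝ} (hw : 1 ≤ w) (hv : w ≤ v) (n : ℕ) :
    0 ≤ (U ℝ n).eval w ∧ (U ℝ n).eval w ≤ (U ℝ n).eval v := by
  induction n using Nat.twoStepInduction with
  | zero => simp
  | one => simp; constructor <;> linarith
  | more n ih _ =>
    have e : ∀ u : ℝ, (U ℝ ((n + 2 : ℕ) : ℤ)).eval u
        = 2 * (T ℝ (n + 2 : ℤ)).eval u + (U ℝ n).eval u := by
      intro u
      push_cast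
      rw [U_eq_two_mul_T_add_U]; simp
    have h1 := one_le_eval_T_real (n + 2 : ℤ) hw
    have h2 := eval_T_mono (n + 2 : ℤ) hw hv
    rw [e, e]
    constructor <;> linarith [ih.1, ih.2]

lemma derivative_T_eval_nonneg_and_mono {w v : ℝ} (m : ℤ) (hw : 1 ≤ w) (hv : w ≤ v) :
    0 ≤ (derivative (T ℝ m)).eval w ∧
      (derivative (T ℝ m)).eval w ≤ (derivative (T ℝ m)).eval v := by
  rw [← T_natAbs]
  rcases m.natAbs with _ | n
  · simp
  · rw [T_derivative_eq_U]
    have h := eval_U_nonneg_and_mono hw hv n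
    have e : (((n + 1 : ℕ) : ℤ) - 1) = n := by push_cast; ring
    rw [e]
    have hn : (0 : ℝ) ≤ n + 1 := by positivity
    simp only [eval_mul, eval_intCast]
    push_cast
    exact ⟨mul_nonneg hn h.1, mul_le_mul_of_nonneg_left h.2 hn⟩

/-- Convexity of the Chebyshev polynomials on `[1, ∞)`. -/
lemma derivative_T_eval_mul_le {w h : ℝ} (m : ℤ) (hw : 1 ≤ w) (hh : 0 < h) :
    (derivative (T ℝ m)).eval w * h ≤ (T ℝ m).eval (w + h) := by
  obtain ⟨c, hc, he⟩ := exists_deriv_eq_slope (fun x => (T ℝ m).eval x) (a := w) (b := w + h)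
    (by linarith) (by fun_prop) (fun x _ => (T ℝ m).differentiableAt.differentiableWithinAt)
  rw [Polynomial.deriv] at he
  have h1 := (derivative_T_eval_nonneg_and_mono m hw hc.1.le).2
  have h2 := one_le_eval_T_real m hw
  rw [add_sub_cancel_left, eq_div_iff hh.ne'] at he
  nlinarith

/-- The left side equals m sinh(mφ), and |sinh| ≤ cosh. The bound is useful when φ is bounded away
from 0; near 0 convexity is used instead. -/
lemma derivative_T_eval_mul_sinh_le (m : ℤ) (φ : ℝ) :
    (derivative (T ℝ m)).eval (Real.cosh φ) * Real.sinh φ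
      ≤ |(m : ℝ)| * (T ℝ m).eval (Real.cosh φ) := by
  rw [T_derivative_eq_U]
  have h := U_real_cosh φ (m - 1)
  push_cast at h
  rw [sub_add_cancel] at h
  simp only [eval_mul, eval_intCast, mul_assoc]
  rw [h, T_real_cosh]
  refine (le_abs_self _).trans ?_
  rw [abs_mul]
  refine mul_le_mul_of_nonneg_left ?_ (abs_nonneg _)
  rw [Real.abs_sinh, ← Real.cosh_abs]
  exact (Real.sinh_lt_cosh _).le

/-- The three-term recursion needs 6w² + 1 ≤ 9w², which holds as |w| ≥ 1. No sign of w is assumed: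
the bound serves arguments far below -1, where the expansion of the exponential is not used. -/
lemma abs_eval_T_le_pow {w : ℝ} (hw : 1 ≤ |w|) (n : ℕ) : |(T ℝ n).eval w| ≤ (3 * |w|) ^ n := by
  induction n using Nat.twoStepInduction with
  | zero => simp
  | one => simp; linarith [abs_nonneg w]
  | more n ih1 ih2 =>
    push_cast at ih2 ⊢
    rw [T_add_two]
    simp only [eval_sub, eval_mul, eval_X, eval_ofNat]
    refine (abs_sub _ _).trans ?_
    rw [abs_mul, abs_mul, abs_two]
    have h0 : 0 ≤ (3 * |w|) ^ n := by positivity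
    calc 2 * |w| * |(T ℝ (n + 1 : ℤ)).eval w| + |(T ℝ n).eval w|
        ≤ 2 * |w| * (3 * |w|) ^ (n + 1) + (3 * |w|) ^ n := by gcongr
      _ = (3 * |w|) ^ n * (6 * |w| ^ 2 + 1) := by ring
      _ ≤ (3 * |w|) ^ n * (9 * |w| ^ 2) := mul_le_mul_of_nonneg_left (by nlinarith) h0
      _ = (3 * |w|) ^ (n + 2) := by ring

lemma abs_eval_U_le_pow {w : ℝ} (hw : 1 ≤ |w|) (n : ℕ) : |(U ℝ n).eval w| ≤ (3 * |w|) ^ n := by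
  induction n using Nat.twoStepInduction with
  | zero => simp
  | one => simp [abs_mul]; linarith [abs_nonneg w]
  | more n ih1 ih2 =>
    push_cast at ih2 ⊢
    rw [U_add_two]
    simp only [eval_sub, eval_mul, eval_X, eval_ofNat]
    refine (abs_sub _ _).trans ?_
    rw [abs_mul, abs_mul, abs_two]
    have h0 : 0 ≤ (3 * |w|) ^ n := by positivity
    calc 2 * |w| * |(U ℝ (n + 1 : ℤ)).eval w| + |(U ℝ n).eval w|
        ≤ 2 * |w| * (3 * |w|) ^ (n + 1) + (3 * |w|) ^ n := by gcongr
      _ = (3 * |w|) ^ n * (6 * |w| ^ 2 + 1) := by ring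
      _ ≤ (3 * |w|) ^ n * (9 * |w| ^ 2) := mul_le_mul_of_nonneg_left (by nlinarith) h0
      _ = (3 * |w|) ^ (n + 2) := by ring

lemma abs_eval_T_le_pow_of_le {w : ℝ} (hw : 1 ≤ |w|) {n : ℕ} {m : ℤ} (hm : |m| ≤ n) :
    |(T ℝ m).eval w| ≤ (3 * |w|) ^ n := by
  rw [← T_natAbs]
  rw [Int.abs_eq_natAbs] at hm
  refine (abs_eval_T_le_pow hw _).trans (pow_le_pow_right₀ (by linarith) (by omega))

lemma abs_derivative_T_eval_le_pow_of_le {w : ℝ} (hw : 1 ≤ |w|) {n : ℕ} {m : ℤ} (hm : |m| ≤ n) :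
    |(derivative (T ℝ m)).eval w| ≤ n * (3 * |w|) ^ n := by
  rw [← T_natAbs]
  rw [Int.abs_eq_natAbs] at hm
  rcases h : m.natAbs with _ | k
  · simp; positivity
  · rw [T_derivative_eq_U]
    have e : (((k + 1 : ℕ) : ℤ) - 1) = k := by push_cast; ring
    rw [e, eval_mul, abs_mul, eval_intCast]
    simp only [Int.cast_natCast, Nat.abs_cast]
    have hk : k + 1 ≤ n := by omega
    gcongr
    exact (abs_eval_U_le_pow hw k).trans (pow_le_pow_right₀ (by linarith) (by omega))

end Polynomial.Chebyshev

/-! ### The Poisson expansion of the exponential in Chebyshev polynomials. -/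

namespace FlatExp

open Polynomial.Chebyshev

/-- The joint probability mass function of two independent Poisson variables of mean `lam / 2`. -/
noncomputable def poissonPair (lam : ℝ) (p : ℕ × ℕ) : ℝ :=
  Real.exp (-lam) * ((lam / 2) ^ p.1 / p.1.factorial) * ((lam / 2) ^ p.2 / p.2.factorial)

/-- The difference of the two components of a pair of natural numbers, as an integer. -/
def pairDiff (p : ℕ × ℕ) : ℤ := p.1 - p.2

lemma poissonPair_nonneg {lam : ℝ} (hl : 0 ≤ lam) (p : ℕ × ℕ) : 0 ≤ poissonPair lam p := by
  unfold poissonPair; positivity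

lemma _root_.HasSum.mul_complex {f g : ℕ → ℂ} {a b : ℂ} (hf : HasSum f a) (hg : HasSum g b) :
    HasSum (fun p : ℕ × ℕ => f p.1 * g p.2) (a * b) :=
  hf.mul hg (summable_mul_of_summable_norm hf.summable.norm hg.summable.norm)

lemma hasSum_pow_div_factorial_cexp (u : ℂ) :
    HasSum (fun n : ℕ => u ^ n / (n.factorial : ℂ)) (Complex.exp u) := by
  rw [Complex.exp_eq_exp_ℂ]
  exact NormedSpace.expSeries_div_hasSum_exp u

lemma poissonPair_mul_cexp (lam : ℝ) (z : ℂ) (p : ℕ × ℕ) :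
    (poissonPair lam p : ℂ) * Complex.exp (pairDiff p * z) = Complex.exp (-lam) *
      ((lam / 2 * Complex.exp z) ^ p.1 / p.1.factorial *
        ((lam / 2 * Complex.exp (-z)) ^ p.2 / p.2.factorial)) := by
  have e : Complex.exp (pairDiff p * z) = Complex.exp z ^ p.1 * Complex.exp (-z) ^ p.2 := by
    rw [← Complex.exp_nat_mul, ← Complex.exp_nat_mul, ← Complex.exp_add]
    congr 1; simp only [pairDiff]; push_cast; ring
  rw [e, mul_pow, mul_pow, poissonPair]
  push_cast
  ring

/-- The moment generating function of a difference of two independent Poisson variables, obtained by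
multiplying the exponential series of (lam/2)e^z and (lam/2)e^{-z}. -/
lemma hasSum_poissonPair_cexp (lam : ℝ) (z : ℂ) :
    HasSum (fun p => (poissonPair lam p : ℂ) * Complex.exp (pairDiff p * z))
      (Complex.exp (lam * (Complex.cosh z - 1))) := by
  have e1 : Complex.exp (lam * (Complex.cosh z - 1)) = Complex.exp (-lam) *
      (Complex.exp (lam / 2 * Complex.exp z) * Complex.exp (lam / 2 * Complex.exp (-z))) := by
    rw [← Complex.exp_add, ← Complex.exp_add, Complex.cosh]
    congr 1
    ring
  rw [e1, funext (poissonPair_mul_cexp lam z)]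
  exact ((hasSum_pow_div_factorial_cexp _).mul_complex (hasSum_pow_div_factorial_cexp _)).mul_left _

lemma hasSum_poissonPair_exp (lam φ : ℝ) :
    HasSum (fun p => poissonPair lam p * Real.exp (pairDiff p * φ))
      (Real.exp (lam * (Real.cosh φ - 1))) := by
  have h := hasSum_poissonPair_cexp lam φ
  rw [← Complex.hasSum_ofReal]
  convert! h using 1
  · funext p; push_cast; rfl
  · push_cast; rfl

lemma hasSum_poissonPair_cosh (lam φ : ℝ) :
    HasSum (fun p => poissonPair lam p * Real.cosh (pairDiff p * φ))
      (Real.exp (lam * (Real.cosh φ - 1))) := by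
  have h1 := hasSum_poissonPair_exp lam φ
  have h2 := hasSum_poissonPair_exp lam (-φ)
  rw [Real.cosh_neg] at h2
  convert! (h1.add h2).div_const 2 using 1
  · funext p
    rw [Real.cosh_eq, mul_neg]; ring
  · ring

lemma hasSum_poissonPair_cos (lam θ : ℝ) :
    HasSum (fun p => poissonPair lam p * Real.cos (pairDiff p * θ))
      (Real.exp (lam * (Real.cos θ - 1))) := by
  have h := Complex.hasSum_re (hasSum_poissonPair_cexp lam (θ * Complex.I))
  convert! h using 1
  · funext p
    rw [Complex.re_ofReal_mul]
    congr 1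
    rw [← mul_assoc]
    have : ((pairDiff p : ℂ) * θ) = ((pairDiff p * θ : ℝ) : ℂ) := by push_cast; rfl
    rw [this, Complex.exp_ofReal_mul_I_re]
  · rw [Complex.cosh_mul_I]
    have : (lam : ℂ) * (Complex.cos θ - 1) = ((lam * (Real.cos θ - 1) : ℝ) : ℂ) := by
      push_cast; rfl
    rw [this, Complex.exp_ofReal_re]

lemma hasSum_poissonPair (lam : ℝ) : HasSum (poissonPair lam) 1 := by
  simpa using hasSum_poissonPair_cosh lam 0

/-- The generating function at z = iθ covers w = cos θ and at z = φ covers w = cosh φ; T_m(cos θ) =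
cos mθ and T_m(cosh φ) = cosh mφ identify the terms. -/
lemma hasSum_poissonPair_T (lam : ℝ) {w : ℝ} (hw : -1 ≤ w) :
    HasSum (fun p => poissonPair lam p * (T ℝ (pairDiff p)).eval w)
      (Real.exp (lam * (w - 1))) := by
  rcases le_total w 1 with h | h
  · have := hasSum_poissonPair_cos lam (Real.arccos w)
    rw [Real.cos_arccos hw h] at this
    convert! this using 3 with p
    rw [← T_real_cos, Real.cos_arccos hw h]
  · have := hasSum_poissonPair_cosh lam (Real.arcosh w)
    rw [Real.cosh_arcosh h] at this
    convert! this using 3 with p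
    rw [← T_real_cosh, Real.cosh_arcosh h]

/-! ### Truncation of the expansion and Chernoff bounds for the tail. -/

/-- The Chebyshev expansion of `exp (lam * (w - 1))`, truncated to degree `n`. -/
noncomputable def truncExp (lam : ℝ) (n : ℕ) : ℝ[X] :=
  ∑ m ∈ Finset.Icc (-n : ℤ) n,
    C (∑' p, if pairDiff p = m then poissonPair lam p else 0) * T ℝ m

lemma summable_poissonPair_ite {lam : ℝ} (hl : 0 ≤ lam) (s : ℕ × ℕ → Prop) [DecidablePred s]
    {f : ℕ × ℕ → ℝ} (hf : Summable fun p => poissonPair lam p * |f p|) :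
    Summable fun p => if s p then poissonPair lam p * f p else 0 := by
  refine Summable.of_norm_bounded hf fun p => ?_
  have h := poissonPair_nonneg hl p
  split_ifs
  · rw [Real.norm_eq_abs, abs_mul, abs_of_nonneg h]
  · simp only [norm_zero]; positivity

lemma summable_poissonPair_ite_le {lam : ℝ} (hl : 0 ≤ lam) (n : ℕ) (f : ℤ → ℝ) :
    Summable fun p => if |pairDiff p| ≤ n then poissonPair lam p * f (pairDiff p) else 0 := by
  have hb : ∀ m ∈ Finset.Icc (-n : ℤ) n, |f m| ≤ ∑ m ∈ Finset.Icc (-n : ℤ) n, |f m| :=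
    fun m hm => Finset.single_le_sum (f := fun m => |f m|) (fun _ _ => abs_nonneg _) hm
  refine Summable.of_norm_bounded
    ((hasSum_poissonPair lam).summable.mul_right (∑ m ∈ Finset.Icc (-n : ℤ) n, |f m|))
    fun p => ?_
  have h := poissonPair_nonneg hl p
  split_ifs with hp
  · rw [Real.norm_eq_abs, abs_mul, abs_of_nonneg h]
    exact mul_le_mul_of_nonneg_left (hb _ (Finset.mem_Icc.2 (abs_le.1 hp))) h
  · simp only [norm_zero]
    exact mul_nonneg h (Finset.sum_nonneg fun _ _ => abs_nonneg _)

/-- Any linear functional of the truncated expansion becomes an expectation over |D| ≤ n. It is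
applied to values, to derivatives and to coefficients after an affine substitution. -/
lemma sum_coeff_mul_eq_tsum {lam : ℝ} (hl : 0 ≤ lam) (n : ℕ) (f : ℤ → ℝ) :
    ∑ m ∈ Finset.Icc (-n : ℤ) n, (∑' p, if pairDiff p = m then poissonPair lam p else 0) * f m
      = ∑' p, if |pairDiff p| ≤ n then poissonPair lam p * f (pairDiff p) else 0 := by
  simp_rw [← tsum_mul_right]
  rw [← Summable.tsum_finsetSum]
  · refine tsum_congr fun p => ?_
    simp_rw [ite_mul, zero_mul]
    rw [Finset.sum_ite_eq]
    simp only [Finset.mem_Icc, abs_le]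
  · intro m _
    refine Summable.mul_right _ ?_
    simpa using summable_poissonPair_ite hl (fun p => pairDiff p = m) (f := fun _ => 1)
      (by simpa using (hasSum_poissonPair lam).summable)

lemma truncExp_eval {lam : ℝ} (hl : 0 ≤ lam) (n : ℕ) (w : ℝ) :
    (truncExp lam n).eval w
      = ∑' p, if |pairDiff p| ≤ n then poissonPair lam p * (T ℝ (pairDiff p)).eval w else 0 := by
  rw [← sum_coeff_mul_eq_tsum hl n fun m => (T ℝ m).eval w]
  simp [truncExp, eval_finsetSum]

lemma truncExp_derivative_eval {lam : ℝ} (hl : 0 ≤ lam) (n : ℕ) (w : ℝ) :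
    (derivative (truncExp lam n)).eval w
      = ∑' p, if |pairDiff p| ≤ n then
          poissonPair lam p * (derivative (T ℝ (pairDiff p))).eval w else 0 := by
  rw [← sum_coeff_mul_eq_tsum hl n fun m => (derivative (T ℝ m)).eval w]
  simp [truncExp, eval_finsetSum]

/-- The tail of the Chebyshev expansion of `exp (lam * (w - 1))`. -/
noncomputable def tailExp (lam : ℝ) (n : ℕ) (w : ℝ) : ℝ :=
  ∑' p, if (n : ℤ) < |pairDiff p| then poissonPair lam p * (T ℝ (pairDiff p)).eval w else 0

lemma truncExp_add_tailExp {lam : ℝ} (hl : 0 ≤ lam) (n : ℕ) {w : ℝ} (hw : -1 ≤ w) :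
    (truncExp lam n).eval w + tailExp lam n w = Real.exp (lam * (w - 1)) := by
  have h := hasSum_poissonPair_T lam hw
  rw [truncExp_eval hl, tailExp, ← h.tsum_eq, ← Summable.tsum_add]
  · refine tsum_congr fun p => ?_
    by_cases hp : |pairDiff p| ≤ n
    · simp [hp, not_lt.2 hp]
    · simp [hp, not_le.1 hp]
  · exact summable_poissonPair_ite_le hl n fun m => (T ℝ m).eval w
  · refine summable_poissonPair_ite hl _ ?_
    simpa [abs_mul, abs_of_nonneg (poissonPair_nonneg hl _)] using h.summable.abs

/-- Chernoff bound for the tail of the difference of two Poisson variables. -/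
lemma tsum_tail_le {lam C φ ψ : ℝ} (hl : 0 ≤ lam) (n : ℕ) {f : ℕ × ℕ → ℝ}
    (hf : ∀ p, (n : ℤ) < |pairDiff p| →
      |f p| ≤ C * (Real.exp (-ψ * n) * Real.cosh (pairDiff p * φ))) (hC : 0 ≤ C) :
    Summable (fun p => if (n : ℤ) < |pairDiff p| then poissonPair lam p * f p else 0) ∧
    |∑' p, if (n : ℤ) < |pairDiff p| then poissonPair lam p * f p else 0|
      ≤ C * Real.exp (-ψ * n + lam * (Real.cosh φ - 1)) := by
  have h := (hasSum_poissonPair_cosh lam φ).mul_left (C * Real.exp (-ψ * n))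
  have hb : ∀ p, ‖if (n : ℤ) < |pairDiff p| then poissonPair lam p * f p else 0‖ ≤
      C * Real.exp (-ψ * n) * (poissonPair lam p * Real.cosh (pairDiff p * φ)) := by
    intro p
    have h0 := poissonPair_nonneg hl p
    have hc := Real.cosh_pos (pairDiff p * φ)
    split_ifs with hp
    · rw [Real.norm_eq_abs, abs_mul, abs_of_nonneg h0]
      refine (mul_le_mul_of_nonneg_left (hf p hp) h0).trans (le_of_eq (by ring))
    · rw [norm_zero]; positivity
  refine ⟨Summable.of_norm_bounded h.summable hb, ?_⟩
  rw [Real.exp_add, ← mul_assoc]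
  exact tsum_of_norm_bounded h hb

lemma exp_abs_mul_le (m : ℤ) (x : ℝ) : Real.exp (|(m : ℝ)| * x) ≤ 2 * Real.cosh (m * x) := by
  rw [Real.cosh_eq]
  rcases abs_cases (m : ℝ) with ⟨h, _⟩ | ⟨h, _⟩ <;> rw [h]
  · linarith [Real.exp_pos (-(m * x))]
  · rw [neg_mul]; linarith [Real.exp_pos (m * x)]

/-- Exponential tilting: since |m| > n, a factor e^{-ψn} is gained by enlarging the exponent φ to φ
+ ψ. -/
lemma cosh_le_of_lt {n : ℕ} {m : ℤ} (hm : (n : ℤ) < |m|) {φ ψ : ℝ} (hφ : 0 ≤ φ) (hψ : 0 ≤ ψ) :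
    Real.cosh (m * φ) ≤ 2 * (Real.exp (-ψ * n) * Real.cosh (m * (φ + ψ))) := by
  have hm' : (n : ℝ) ≤ |(m : ℝ)| := by exact_mod_cast hm.le
  have h1 : Real.cosh (m * φ) ≤ Real.exp (|(m : ℝ)| * φ) := by
    rw [← Real.cosh_abs, abs_mul, abs_of_nonneg hφ, Real.cosh_eq]
    have : Real.exp (-(|(m : ℝ)| * φ)) ≤ Real.exp (|(m : ℝ)| * φ) :=
      Real.exp_le_exp.2 (by linarith [mul_nonneg (abs_nonneg (m : ℝ)) hφ])
    linarith
  have h2 : Real.exp (|(m : ℝ)| * φ) ≤ Real.exp (-ψ * n) * Real.exp (|(m : ℝ)| * (φ + ψ)) := by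
    rw [← Real.exp_add]
    exact Real.exp_le_exp.2 (by nlinarith)
  nlinarith [exp_abs_mul_le m (φ + ψ), Real.exp_pos (-ψ * n)]

/-- One ψ of exponent absorbs m², through t² ≤ 2e^t at t = |m|ψ; a second ψ is spent on the tilting.
Hence the 2ψ on the right. -/
lemma sq_le_of_lt {n : ℕ} {m : ℤ} (hm : (n : ℤ) < |m|) {ψ : ℝ} (hψ : 0 < ψ) :
    (m : ℝ) ^ 2 ≤ 4 / ψ ^ 2 * (Real.exp (-ψ * n) * Real.cosh (m * (2 * ψ))) := by
  have hm' : (n : ℝ) ≤ |(m : ℝ)| := by exact_mod_cast hm.le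
  have h0 : 0 ≤ |(m : ℝ)| * ψ := by positivity
  have h1 : (|(m : ℝ)| * ψ) ^ 2 ≤ 2 * Real.exp (|(m : ℝ)| * ψ) := by
    linarith [Real.quadratic_le_exp_of_nonneg h0]
  have h2 : Real.exp (|(m : ℝ)| * ψ) ≤ Real.exp (-ψ * n) * Real.exp (|(m : ℝ)| * (2 * ψ)) := by
    rw [← Real.exp_add]
    exact Real.exp_le_exp.2 (by nlinarith)
  have h3 := exp_abs_mul_le m (2 * ψ)
  have h4 : (m : ℝ) ^ 2 * ψ ^ 2 ≤ 4 * (Real.exp (-ψ * n) * Real.cosh (m * (2 * ψ))) := by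
    rw [← sq_abs, ← mul_pow]
    nlinarith [Real.exp_pos (-ψ * n)]
  rw [div_mul_eq_mul_div, le_div_iff₀ (by positivity)]
  exact h4

lemma abs_tailExp_le {lam ψ : ℝ} (hl : 0 ≤ lam) (hψ : 0 ≤ ψ) (n : ℕ) {w : ℝ} (hw : |w| ≤ 1) :
    |tailExp lam n w| ≤ 2 * Real.exp (-ψ * n + lam * (Real.cosh ψ - 1)) := by
  refine (tsum_tail_le hl n (fun p hp => ?_) (by norm_num)).2
  refine (abs_eval_T_real_le_one _ hw).trans ?_
  simpa using cosh_le_of_lt hp le_rfl hψ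

lemma abs_tailExp_cosh_le {lam φ ψ : ℝ} (hl : 0 ≤ lam) (hφ : 0 ≤ φ) (hψ : 0 ≤ ψ) (n : ℕ) :
    |tailExp lam n (Real.cosh φ)| ≤
      2 * Real.exp (-ψ * n + lam * (Real.cosh (φ + ψ) - 1)) := by
  refine (tsum_tail_le hl n (fun p hp => ?_) (by norm_num)).2
  rw [T_real_cosh, abs_of_pos (Real.cosh_pos _)]
  exact cosh_le_of_lt hp hφ hψ

lemma tailExp_nonneg {lam : ℝ} (hl : 0 ≤ lam) (n : ℕ) {w : ℝ} (hw : 1 ≤ w) :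
    0 ≤ tailExp lam n w := by
  refine tsum_nonneg fun p => ?_
  split_ifs
  · exact mul_nonneg (poissonPair_nonneg hl p) (by linarith [one_le_eval_T_real (pairDiff p) hw])
  · exact le_rfl

lemma hasDerivAt_tailExp {lam ψ : ℝ} (hl : 0 ≤ lam) (hψ : 0 < ψ) (n : ℕ) {w : ℝ} (hw : |w| < 1) :
    ∃ t, HasDerivAt (tailExp lam n) t w ∧
      |t| ≤ 4 / ψ ^ 2 * Real.exp (-ψ * n + lam * (Real.cosh (2 * ψ) - 1)) := by
  have hsq := tsum_tail_le (φ := 2 * ψ) (ψ := ψ) (C := 4 / ψ ^ 2) hl n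
    (f := fun p => (pairDiff p : ℝ) ^ 2)
    (fun p hp => by rw [abs_of_nonneg (sq_nonneg _)]; exact sq_le_of_lt hp hψ) (by positivity)
  have hd := tsum_tail_le (φ := 2 * ψ) (ψ := ψ) (C := 4 / ψ ^ 2) hl n
    (f := fun p => (derivative (T ℝ (pairDiff p))).eval w)
    (fun p hp => (abs_derivative_T_eval_le _ hw.le).trans (sq_le_of_lt hp hψ)) (by positivity)
  refine ⟨_, ?_, hd.2⟩
  have h0 : Summable fun p => if (n : ℤ) < |pairDiff p| then
      poissonPair lam p * (T ℝ (pairDiff p)).eval 0 else 0 := by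
    refine summable_poissonPair_ite hl _ ?_
    simpa [abs_mul, abs_of_nonneg (poissonPair_nonneg hl _)] using
      (hasSum_poissonPair_T lam (w := 0) (by norm_num)).summable.abs
  -- Termwise differentiation on (-1,1): the derivatives are dominated by the summable series of m²
  -- weights, and convergence is checked at the base point 0.
  refine hasDerivAt_tsum_of_isPreconnected
    (g := fun p w => if (n : ℤ) < |pairDiff p| then
      poissonPair lam p * (T ℝ (pairDiff p)).eval w else 0)
    (g' := fun p w => if (n : ℤ) < |pairDiff p| then
      poissonPair lam p * (derivative (T ℝ (pairDiff p))).eval w else 0)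
    hsq.1 (isOpen_Ioo (a := (-1 : ℝ)) (b := 1))
    isPreconnected_Ioo (fun p y _ => ?_) (fun p y hy => ?_) (y₀ := 0) (by norm_num) h0
    (abs_lt.1 hw)
  · split_ifs
    · exact ((T ℝ (pairDiff p)).hasDerivAt y).const_mul _
    · exact hasDerivAt_const _ _
  · split_ifs
    · rw [Real.norm_eq_abs, abs_mul, abs_of_nonneg (poissonPair_nonneg hl p)]
      exact mul_le_mul_of_nonneg_left (abs_derivative_T_eval_le _ (abs_lt.2 hy).le)
        (poissonPair_nonneg hl p)
    · simp

lemma abs_truncExp_derivative_sub_le {lam ψ : ℝ} (hl : 0 ≤ lam) (hψ : 0 < ψ) (n : ℕ) {w : ℝ}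
    (hw : |w| < 1) :
    |(derivative (truncExp lam n)).eval w - lam * Real.exp (lam * (w - 1))|
      ≤ 4 / ψ ^ 2 * Real.exp (-ψ * n + lam * (Real.cosh (2 * ψ) - 1)) := by
  obtain ⟨t, ht, hb⟩ := hasDerivAt_tailExp hl hψ n hw
  have h1 := ((truncExp lam n).hasDerivAt w).add ht
  have h2 : HasDerivAt (fun w => Real.exp (lam * (w - 1))) (lam * Real.exp (lam * (w - 1))) w := by
    have := (((hasDerivAt_id w).sub_const 1).const_mul lam).exp
    simpa [mul_comm] using this
  have h3 := h2.congr_of_eventuallyEq (f₁ := fun w => (truncExp lam n).eval w + tailExp lam n w)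
    (by
      filter_upwards [isOpen_Ioo.mem_nhds (abs_lt.1 hw)] with x hx
      exact truncExp_add_tailExp hl n hx.1.le)
  rw [← h1.unique h3, sub_add_cancel_left, abs_neg]
  exact hb

lemma truncExp_eval_nonneg {lam : ℝ} (hl : 0 ≤ lam) (n : ℕ) {w : ℝ} (hw : 1 ≤ w) :
    0 ≤ (truncExp lam n).eval w := by
  rw [truncExp_eval hl]
  refine tsum_nonneg fun p => ?_
  split_ifs
  · exact mul_nonneg (poissonPair_nonneg hl p) (by linarith [one_le_eval_T_real (pairDiff p) hw])
  · exact le_rfl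

lemma truncExp_derivative_eval_nonneg {lam : ℝ} (hl : 0 ≤ lam) (n : ℕ) {w : ℝ} (hw : 1 ≤ w) :
    0 ≤ (derivative (truncExp lam n)).eval w := by
  rw [truncExp_derivative_eval hl]
  refine tsum_nonneg fun p => ?_
  split_ifs
  · exact mul_nonneg (poissonPair_nonneg hl p)
      (derivative_T_eval_nonneg_and_mono (pairDiff p) hw le_rfl).1
  · exact le_rfl

lemma truncExp_eval_le {lam : ℝ} (hl : 0 ≤ lam) (n : ℕ) {w : ℝ} (hw : 1 ≤ w) :
    (truncExp lam n).eval w ≤ Real.exp (lam * (w - 1)) := by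
  linarith [truncExp_add_tailExp hl n (w := w) (by linarith), tailExp_nonneg hl n hw]

lemma truncExp_derivative_eval_mul_le {lam h : ℝ} (hl : 0 ≤ lam) (n : ℕ) {w : ℝ} (hw : 1 ≤ w)
    (hh : 0 < h) :
    (derivative (truncExp lam n)).eval w * h ≤ (truncExp lam n).eval (w + h) := by
  rw [truncExp_derivative_eval hl, truncExp_eval hl, ← tsum_mul_right]
  have hs := summable_poissonPair_ite_le hl n fun m => (derivative (T ℝ m)).eval w
  refine Summable.tsum_le_tsum (fun p => ?_) (hs.mul_right h)
    (summable_poissonPair_ite_le hl n fun m => (T ℝ m).eval (w + h))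
  split_ifs
  · rw [mul_assoc]
    exact mul_le_mul_of_nonneg_left (derivative_T_eval_mul_le _ hw hh) (poissonPair_nonneg hl p)
  · simp

lemma truncExp_derivative_eval_mul_sinh_le {lam : ℝ} (hl : 0 ≤ lam) (n : ℕ) (φ : ℝ) :
    (derivative (truncExp lam n)).eval (Real.cosh φ) * Real.sinh φ
      ≤ n * (truncExp lam n).eval (Real.cosh φ) := by
  rw [truncExp_derivative_eval hl, truncExp_eval hl, ← tsum_mul_right, ← tsum_mul_left]
  have hs := summable_poissonPair_ite_le hl n fun m => (derivative (T ℝ m)).eval (Real.cosh φ)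
  have hs' := summable_poissonPair_ite_le hl n fun m => (T ℝ m).eval (Real.cosh φ)
  refine Summable.tsum_le_tsum (fun p => ?_) (hs.mul_right _) (hs'.mul_left _)
  split_ifs with hp
  · have hp' : |(pairDiff p : ℝ)| ≤ n := by exact_mod_cast hp
    have h1 := one_le_eval_T_real (pairDiff p) (Real.one_le_cosh φ)
    rw [mul_assoc, mul_left_comm (n : ℝ)]
    refine mul_le_mul_of_nonneg_left ?_ (poissonPair_nonneg hl p)
    exact (derivative_T_eval_mul_sinh_le _ φ).trans
      (mul_le_mul_of_nonneg_right hp' (by linarith))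
  · simp

/-- The weights have total mass 1, so a truncated expectation is bounded by the largest absolute
value on |m| ≤ n. -/
lemma abs_tsum_ite_le {lam : ℝ} (hl : 0 ≤ lam) (n : ℕ) {f : ℤ → ℝ} {B : ℝ} (hB : 0 ≤ B)
    (hf : ∀ m : ℤ, |m| ≤ n → |f m| ≤ B) :
    |∑' p, if |pairDiff p| ≤ n then poissonPair lam p * f (pairDiff p) else 0| ≤ B := by
  have h := (hasSum_poissonPair lam).mul_right B
  rw [one_mul] at h
  rw [← Real.norm_eq_abs]
  refine tsum_of_norm_bounded h fun p => ?_
  have h0 := poissonPair_nonneg hl p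
  split_ifs with hp
  · rw [Real.norm_eq_abs, abs_mul, abs_of_nonneg h0]
    exact mul_le_mul_of_nonneg_left (hf _ hp) h0
  · rw [norm_zero]; positivity

lemma abs_truncExp_eval_le_pow {lam : ℝ} (hl : 0 ≤ lam) (n : ℕ) {w : ℝ} (hw : 1 ≤ |w|) :
    |(truncExp lam n).eval w| ≤ (3 * |w|) ^ n := by
  rw [truncExp_eval hl]
  exact abs_tsum_ite_le hl n (f := fun m => (T ℝ m).eval w) (by positivity)
    fun m hm => abs_eval_T_le_pow_of_le hw hm

lemma abs_truncExp_derivative_eval_le_pow {lam : ℝ} (hl : 0 ≤ lam) (n : ℕ) {w : ℝ}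
    (hw : 1 ≤ |w|) :
    |(derivative (truncExp lam n)).eval w| ≤ n * (3 * |w|) ^ n := by
  rw [truncExp_derivative_eval hl]
  exact abs_tsum_ite_le hl n (f := fun m => (derivative (T ℝ m)).eval w) (by positivity)
    fun m hm => abs_derivative_T_eval_le_pow_of_le hw hm

lemma natDegree_truncExp_le (lam : ℝ) (n : ℕ) : (truncExp lam n).natDegree ≤ n := by
  refine natDegree_sum_le_of_forall_le _ _ fun m hm => ?_
  refine (natDegree_C_mul_le _ _).trans ?_
  rw [natDegree_T]
  rw [Finset.mem_Icc] at hm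
  omega

/-! ### The approximation of exp(-x/2) on a long window. -/

/-- Admissible parameters for the construction: `n` is comparable to `10⁶ β² L`. -/
structure Admissible (β L : ℝ) (n : ℕ) : Prop where
  one_le_beta : 1 ≤ β
  one_le_L : 1 ≤ L
  le_n : 10 ^ 6 * β ^ 2 * L ≤ n
  n_le : n ≤ 2 * 10 ^ 6 * β ^ 2 * L

/-- The length of the interval on which the Chebyshev expansion is used. -/
noncomputable def width (β : ℝ) (n : ℕ) : ℝ := 1000 * β * (n + 1)

/-- A polynomial approximating `exp (-x / 2)` on `[-β L, width β n - β L]`. -/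
noncomputable def halfExp (β L : ℝ) (n : ℕ) : ℝ[X] :=
  C (Real.exp (β * L / 2)) *
    (truncExp (width β n / 4) n).comp (C (1 - 2 * (β * L) / width β n) - C (2 / width β n) * X)

/-- The argument of the Chebyshev expansion corresponding to `x`. -/
noncomputable def chebArg (β L : ℝ) (n : ℕ) (x : ℝ) : ℝ := 1 - 2 * (x + β * L) / width β n

lemma halfExp_eval (β L : ℝ) (n : ℕ) (x : ℝ) :
    (halfExp β L n).eval x =
      Real.exp (β * L / 2) * (truncExp (width β n / 4) n).eval (chebArg β L n x) := by
  simp only [halfExp, eval_mul, eval_C, eval_comp, eval_sub, eval_X, chebArg]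
  congr 2
  ring

lemma halfExp_derivative_eval (β L : ℝ) (n : ℕ) (x : ℝ) :
    (derivative (halfExp β L n)).eval x =
      -(2 / width β n * Real.exp (β * L / 2) *
        (derivative (truncExp (width β n / 4) n)).eval (chebArg β L n x)) := by
  simp only [halfExp, derivative_C_mul, derivative_comp, derivative_sub, derivative_C,
    derivative_X, eval_mul, eval_C, eval_comp, eval_sub, eval_X, chebArg, eval_zero, eval_one]
  rw [show 1 - 2 * (β * L) / width β n - 2 / width β n * x = 1 - 2 * (x + β * L) / width β n by ring]
  ring

lemma cosh_sub_one_le_sq {x : ℝ} (hx : |x| ≤ 1) : Real.cosh x - 1 ≤ x ^ 2 := by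
  have h1 := Real.cosh_le_exp_half_sq x
  have h0 : x ^ 2 ≤ 1 := by rw [← sq_abs]; nlinarith [abs_nonneg x]
  have h2 := Real.abs_exp_sub_one_le (x := x ^ 2 / 2) (by
    rw [abs_of_nonneg (by positivity)]; linarith)
  rw [abs_of_nonneg (show 0 ≤ x ^ 2 / 2 by positivity)] at h2
  linarith [le_abs_self (Real.exp (x ^ 2 / 2) - 1)]

lemma width_pos {β L : ℝ} {n : ℕ} (h : Admissible β L n) : 0 < width β n := by
  have := h.one_le_beta
  unfold width; positivity

lemma betaL_facts {β L : ℝ} {n : ℕ} (h : Admissible β L n) :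
    L ≤ β * L ∧ 10 ^ 6 * (β * L) ≤ n / β ∧ 10 ^ 6 * (β * L) ≤ n ∧ 10 ^ 6 * β ≤ n := by
  have h1 := h.one_le_beta
  have h2 := h.one_le_L
  have h3 := h.le_n
  have h4 : β ≤ β ^ 2 := by nlinarith
  have h5 : β ≤ β * L := by nlinarith
  have h6 : β * L ≤ β ^ 2 * L := by nlinarith
  refine ⟨by nlinarith, ?_, by nlinarith, by nlinarith⟩
  rw [le_div_iff₀ (by linarith)]
  nlinarith

lemma four_betaL_le_width {β L : ℝ} {n : ℕ} (h : Admissible β L n) :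
    4 * (β * L) ≤ width β n := by
  have h1 := h.one_le_beta
  obtain ⟨-, -, h2, -⟩ := betaL_facts h
  have h0 : (n : ℝ) ≤ β * n := by nlinarith [Nat.cast_nonneg (α := ℝ) n]
  have : 0 ≤ β * L := by have := h.one_le_L; positivity
  unfold width
  nlinarith

lemma exp_chebArg {β L : ℝ} {n : ℕ} (h : Admissible β L n) (x : ℝ) :
    Real.exp (β * L / 2) * Real.exp (width β n / 4 * (chebArg β L n x - 1))
      = Real.exp (-x / 2) := by
  have := (width_pos h).ne'
  rw [← Real.exp_add, chebArg]
  congr 1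
  field_simp
  ring

/-- Uses cosh φ - 1 ≤ φ² for φ ≤ 1. The value c = 1 serves points inside the window and c = 2 points
slightly to its left; the factor 1.1 absorbs n + 1 against n. -/
lemma chernoff_exponent_le {β L : ℝ} {n : ℕ} (h : Admissible β L n) {c φ : ℝ} (hφ : 0 ≤ φ)
    (hφ' : φ ≤ c / (2000 * β)) (hc : c ≤ 2) :
    width β n / 4 * (Real.cosh φ - 1) ≤ c ^ 2 * (1.1 * n / (16000 * β)) := by
  have h1 := h.one_le_beta
  obtain ⟨-, -, -, h4⟩ := betaL_facts h
  have hφ1 : φ ≤ 1 := hφ'.trans (by rw [div_le_one (by positivity)]; linarith)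
  have hsq : φ ^ 2 ≤ (c / (2000 * β)) ^ 2 := by gcongr
  have h3 := (cosh_sub_one_le_sq (x := φ) (by rw [abs_of_nonneg hφ]; exact hφ1)).trans hsq
  calc width β n / 4 * (Real.cosh φ - 1) ≤ width β n / 4 * (c / (2000 * β)) ^ 2 :=
        mul_le_mul_of_nonneg_left h3 (by have := width_pos h; positivity)
    _ = c ^ 2 * ((n + 1) / (16000 * β)) := by
        unfold width; field_simp; ring
    _ ≤ c ^ 2 * (1.1 * n / (16000 * β)) := by gcongr; linarith

/-- The error allowed in the approximation of `exp (-x / 2)`. -/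
noncomputable def halfErr (β L : ℝ) : ℝ := Real.exp (-(β * L) - 2 * L) / 32

/-- Since n/β ≥ 10⁶βL, the exponent e is at most -100βL, which pays for e^{βL/2}, for the target
e^{-βL-2L} and for the constant 64 = 2·32. -/
lemma small_exp_le {β L : ℝ} {n : ℕ} (h : Admissible β L n) {e : ℝ}
    (he : e ≤ -n / (10000 * β)) : 2 * (Real.exp (β * L / 2) * Real.exp e) ≤ halfErr β L := by
  have h1 := h.one_le_beta
  obtain ⟨h2, h3, -, -⟩ := betaL_facts h
  have hL := h.one_le_L
  have e1 : -n / (10000 * β) = -(n / β) / 10000 := by field_simp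
  rw [e1] at he
  rw [halfErr, le_div_iff₀ (by norm_num), ← Real.exp_add]
  have h64 : (64 : ℝ) ≤ Real.exp 64 := by linarith [Real.add_one_le_exp (64 : ℝ)]
  calc 2 * Real.exp (β * L / 2 + e) * 32 = 64 * Real.exp (β * L / 2 + e) := by ring
    _ ≤ Real.exp 64 * Real.exp (β * L / 2 + e) := by gcongr
    _ = Real.exp (64 + (β * L / 2 + e)) := by rw [← Real.exp_add]
    _ ≤ _ := Real.exp_le_exp.2 (by linarith)

lemma abs_halfExp_sub_le {β L : ℝ} {n : ℕ} (h : Admissible β L n) {x : ℝ}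
    (hx : -(β * L) ≤ x) (hx' : x ≤ width β n - β * L) :
    |(halfExp β L n).eval x - Real.exp (-x / 2)| ≤ halfErr β L := by
  have h1 := h.one_le_beta
  have hw := width_pos h
  have hl : 0 ≤ width β n / 4 := by positivity
  have e1 : 2 * (x + β * L) / width β n ≤ 2 := by rw [div_le_iff₀ hw]; linarith
  have e2 : 0 ≤ 2 * (x + β * L) / width β n := div_nonneg (by linarith) hw.le
  have hc : |chebArg β L n x| ≤ 1 := by
    rw [abs_le, chebArg]; constructor <;> linarith
  have hc' := (abs_le.1 hc).1
  have ht := abs_tailExp_le (ψ := 1 / (2000 * β)) hl (by positivity) n hc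
  have hadd := truncExp_add_tailExp hl n hc'
  rw [halfExp_eval, ← exp_chebArg h, ← mul_sub, ← hadd, sub_add_cancel_left, abs_mul, abs_neg,
    abs_of_pos (Real.exp_pos _)]
  have hce := chernoff_exponent_le h (c := 1) (φ := 1 / (2000 * β)) (by positivity) le_rfl
    (by norm_num)
  refine le_trans ?_ (small_exp_le h
    (e := -(1 / (2000 * β)) * n + width β n / 4 * (Real.cosh (1 / (2000 * β)) - 1)) ?_)
  · rw [mul_left_comm]
    exact mul_le_mul_of_nonneg_left ht (Real.exp_pos _).le
  · refine (add_le_add le_rfl hce).trans ?_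
    have : (0 : ℝ) ≤ n / β := by positivity
    have e3 : -(1 / (2000 * β)) * n + 1 ^ 2 * (1.1 * n / (16000 * β))
        = (n / β) * (-1 / 2000 + 1.1 / 16000) := by field_simp
    have e4 : -n / (10000 * β) = (n / β) * (-1 / 10000) := by field_simp
    rw [e3, e4]
    exact mul_le_mul_of_nonneg_left (by norm_num) this

lemma abs_halfExp_derivative_add_le {β L : ℝ} {n : ℕ} (h : Admissible β L n) {x : ℝ}
    (hx : -(β * L) < x) (hx' : x < width β n - β * L) :
    |(derivative (halfExp β L n)).eval x + Real.exp (-x / 2) / 2| ≤ halfErr β L := by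
  have h1 := h.one_le_beta
  have hw := width_pos h
  have hl : 0 ≤ width β n / 4 := by positivity
  have e1 : 2 * (x + β * L) / width β n < 2 := by rw [div_lt_iff₀ hw]; linarith
  have e2 : 0 < 2 * (x + β * L) / width β n := div_pos (by linarith) hw
  have hc : |chebArg β L n x| < 1 := by
    rw [abs_lt, chebArg]; constructor <;> linarith
  -- The tail derivative is estimated at 2ψ, so ψ is half the value used for the function itself and
  -- the Chernoff exponent again has c = 1.
  have ht := abs_truncExp_derivative_sub_le (ψ := 1 / (4000 * β)) hl (by positivity) n hc
  rw [halfExp_derivative_eval, ← exp_chebArg h]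
  set g := (derivative (truncExp (width β n / 4) n)).eval (chebArg β L n x)
  set E := Real.exp (width β n / 4 * (chebArg β L n x - 1))
  have e3 : -(2 / width β n * Real.exp (β * L / 2) * g) + Real.exp (β * L / 2) * E / 2
      = -(2 / width β n * Real.exp (β * L / 2) * (g - width β n / 4 * E)) := by
    field_simp; ring
  rw [e3, abs_neg, abs_mul, abs_of_pos (by positivity)]
  obtain ⟨-, -, -, hn⟩ := betaL_facts h
  have hce := chernoff_exponent_le h (c := 1) (φ := 2 * (1 / (4000 * β))) (by positivity)
    (le_of_eq (by field_simp; norm_num)) (by norm_num)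
  set e := -(1 / (4000 * β)) * n + width β n / 4 * (Real.cosh (2 * (1 / (4000 * β))) - 1) with hedef
  refine le_trans ?_ (small_exp_le h (e := e) ?_)
  -- The loss 4/ψ² is of order β², the chain rule factor of order 1/(βn), and n ≥ 10⁶β makes their
  -- product at most 2.
  · have e5 : 2 / width β n * (4 / (1 / (4000 * β)) ^ 2) ≤ 2 := by
      rw [show 2 / width β n * (4 / (1 / (4000 * β)) ^ 2) = 128000 * β / (n + 1) by
        unfold width; field_simp; ring, div_le_iff₀ (by positivity)]
      linarith
    calc _ ≤ 2 / width β n * Real.exp (β * L / 2) * (4 / (1 / (4000 * β)) ^ 2 * Real.exp e) :=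
          mul_le_mul_of_nonneg_left ht (by positivity)
      _ = 2 / width β n * (4 / (1 / (4000 * β)) ^ 2) * (Real.exp (β * L / 2) * Real.exp e) := by
          ring
      _ ≤ _ := mul_le_mul_of_nonneg_right e5 (by positivity)
  · refine (add_le_add le_rfl hce).trans ?_
    have : (0 : ℝ) ≤ n / β := by positivity
    have e3 : -(1 / (4000 * β)) * n + 1 ^ 2 * (1.1 * n / (16000 * β))
        = (n / β) * (-1 / 4000 + 1.1 / 16000) := by field_simp
    have e4 : -n / (10000 * β) = (n / β) * (-1 / 10000) := by field_simp
    rw [e3, e4]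
    exact mul_le_mul_of_nonneg_left (by norm_num) this

lemma one_le_chebArg {β L : ℝ} {n : ℕ} (h : Admissible β L n) {x : ℝ} (hx : x ≤ -(β * L)) :
    1 ≤ chebArg β L n x := by
  have : 2 * (x + β * L) / width β n ≤ 0 :=
    div_nonpos_of_nonpos_of_nonneg (by linarith) (width_pos h).le
  unfold chebArg; linarith

lemma halfExp_eval_nonneg {β L : ℝ} {n : ℕ} (h : Admissible β L n) {x : ℝ} (hx : x ≤ -(β * L)) :
    0 ≤ (halfExp β L n).eval x := by
  rw [halfExp_eval]
  exact mul_nonneg (Real.exp_pos _).le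
    (truncExp_eval_nonneg (by linarith [width_pos h]) n (one_le_chebArg h hx))

lemma halfExp_eval_le {β L : ℝ} {n : ℕ} (h : Admissible β L n) {x : ℝ} (hx : x ≤ -(β * L)) :
    (halfExp β L n).eval x ≤ Real.exp (-x / 2) := by
  rw [halfExp_eval, ← exp_chebArg h]
  exact mul_le_mul_of_nonneg_left
    (truncExp_eval_le (by linarith [width_pos h]) n (one_le_chebArg h hx)) (Real.exp_pos _).le

/-- Let w = cosh φ, lam = width/4, and let Q be the truncation. For small φ the tail is still
negligible, so Q(w) ≥ e^{lam(w-1)}/2, while convexity over a step 1/lam gives Q'(w)/lam ≤ Q(w +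
1/lam) ≤ e·e^{lam(w-1)}. For larger φ, Q'(w) sinh φ ≤ nQ(w) with sinh φ ≥ 1/(2000β) suffices. -/
lemma truncExp_derivative_le_mul {β L : ℝ} {n : ℕ} (h : Admissible β L n) {w : ℝ} (hw : 1 ≤ w) :
    2 / width β n * (derivative (truncExp (width β n / 4) n)).eval w
      ≤ 4 * (truncExp (width β n / 4) n).eval w := by
  have h1 := h.one_le_beta
  have hb := width_pos h
  have hl : 0 < width β n / 4 := by positivity
  have hφ := Real.arcosh_nonneg hw
  have hcosh := Real.cosh_arcosh hw
  set φ := Real.arcosh w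
  have hg := truncExp_eval_nonneg hl.le n hw
  have hg' := truncExp_derivative_eval_nonneg hl.le n hw
  rcases le_total φ (1 / (2000 * β)) with hs | hs
  · have h2 := truncExp_derivative_eval_mul_le (h := 1 / (width β n / 4)) hl.le n hw (by positivity)
    have h3 := truncExp_eval_le hl.le n (w := w + 1 / (width β n / 4))
      (by linarith [show 0 < 1 / (width β n / 4) by positivity])
    rw [show width β n / 4 * (w + 1 / (width β n / 4) - 1) = width β n / 4 * (w - 1) + 1 by
      field_simp; ring, Real.exp_add] at h3
    have h4 := truncExp_add_tailExp hl.le n (w := w) (by linarith)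
    have h5 := abs_tailExp_cosh_le (ψ := 1 / (2000 * β)) hl.le hφ (by positivity) n
    have hce := chernoff_exponent_le h (c := 2) (φ := φ + 1 / (2000 * β)) (by positivity)
      (by rw [show 2 / (2000 * β) = 1 / (2000 * β) + 1 / (2000 * β) by ring]; linarith) le_rfl
    have h6 := small_exp_le h
      (e := -(1 / (2000 * β)) * n + width β n / 4 * (Real.cosh (φ + 1 / (2000 * β)) - 1)) (by
        refine (add_le_add le_rfl hce).trans ?_
        have : (0 : ℝ) ≤ n / β := by positivity
        have e3 : -(1 / (2000 * β)) * n + 2 ^ 2 * (1.1 * n / (16000 * β))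
          = (n / β) * (-1 / 2000 + 4.4 / 16000) := by field_simp; norm_num
        have e4 : -n / (10000 * β) = (n / β) * (-1 / 10000) := by field_simp
        rw [e3, e4]
        exact mul_le_mul_of_nonneg_left (by norm_num) this)
    have h7 : halfErr β L ≤ 1 / 4 := by
      have : Real.exp (-(β * L) - 2 * L) ≤ 1 := Real.exp_le_one_iff.2 (by
        have := h.one_le_L; have := (betaL_facts h).1; linarith)
      unfold halfErr; linarith
    have h8 : 1 ≤ Real.exp (β * L / 2) := Real.one_le_exp (by
      have := h.one_le_L; positivity)
    rw [hcosh] at h5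
    have h9 : 1 ≤ Real.exp (width β n / 4 * (w - 1)) := Real.one_le_exp (by
      have : 0 ≤ w - 1 := by linarith
      positivity)
    set e := Real.exp (-(1 / (2000 * β)) * n +
      width β n / 4 * (Real.cosh (φ + 1 / (2000 * β)) - 1))
    set E := Real.exp (width β n / 4 * (w - 1))
    have he : 0 < e := Real.exp_pos _
    have h10 : E / 2 ≤ (truncExp (width β n / 4) n).eval w := by
      have : tailExp (width β n / 4) n w ≤ 1 / 4 := by
        refine (le_abs_self _).trans (h5.trans ?_)
        nlinarith
      linarith
    have h11 : 2 / width β n * (derivative (truncExp (width β n / 4) n)).eval w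
        = (derivative (truncExp (width β n / 4) n)).eval w * (1 / (width β n / 4)) / 2 := by
      field_simp; norm_num
    rw [h11]
    have h12 := Real.exp_one_lt_d9
    nlinarith
  · have h2 := truncExp_derivative_eval_mul_sinh_le hl.le n φ
    rw [hcosh] at h2
    have h3 : 1 / (2000 * β) ≤ Real.sinh φ := hs.trans (Real.self_le_sinh_iff.2 hφ)
    have h4 := (mul_le_mul_of_nonneg_left h3 hg').trans h2
    have h5 : 2 / width β n * (derivative (truncExp (width β n / 4) n)).eval w
        = 4 / (n + 1) * ((derivative (truncExp (width β n / 4) n)).eval w * (1 / (2000 * β))) := by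
      unfold width; field_simp; ring
    rw [h5]
    calc _ ≤ 4 / (n + 1 : ℝ) * (n * (truncExp (width β n / 4) n).eval w) := by gcongr
      _ = 4 * (n / (n + 1 : ℝ)) * (truncExp (width β n / 4) n).eval w := by ring
      _ ≤ 4 * 1 * (truncExp (width β n / 4) n).eval w := by
        gcongr
        rw [div_le_one (by positivity)]; linarith
      _ = _ := by ring

lemma abs_halfExp_derivative_le_mul {β L : ℝ} {n : ℕ} (h : Admissible β L n) {x : ℝ}
    (hx : x ≤ -(β * L)) :
    |(derivative (halfExp β L n)).eval x| ≤ 4 * (halfExp β L n).eval x := by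
  have hw := one_le_chebArg h hx
  have hb := width_pos h
  rw [halfExp_derivative_eval, halfExp_eval, abs_neg, abs_of_nonneg]
  · have := mul_le_mul_of_nonneg_left (truncExp_derivative_le_mul h hw)
      (Real.exp_pos (β * L / 2)).le
    linarith
  · have := truncExp_derivative_eval_nonneg (lam := width β n / 4) (by positivity) n hw
    positivity

lemma abs_halfExp_le_pow {β L : ℝ} {n : ℕ} (h : Admissible β L n) {x : ℝ}
    (hx : width β n - β * L ≤ x) :
    |(halfExp β L n).eval x| ≤ Real.exp (β * L / 2) * (12 * x / width β n) ^ n ∧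
    |(derivative (halfExp β L n)).eval x| ≤ Real.exp (β * L / 2) * (12 * x / width β n) ^ n := by
  have h1 := h.one_le_beta
  have hb := width_pos h
  have hl : 0 ≤ width β n / 4 := by positivity
  have hw4 := four_betaL_le_width h
  have hL := h.one_le_L
  have hK : 0 ≤ β * L := by positivity
  have e1 : 2 ≤ 2 * (x + β * L) / width β n := by rw [le_div_iff₀ hb]; linarith
  have hc : 1 ≤ |chebArg β L n x| := by
    rw [chebArg, le_abs]; right; linarith
  have hc' : 3 * |chebArg β L n x| ≤ 12 * x / width β n := by
    -- Right of the window x ≥ βL, so x + βL ≤ 2x.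
    rw [chebArg, abs_of_nonpos (by linarith)]
    have : 2 * (x + β * L) / width β n ≤ 4 * x / width β n :=
      div_le_div_of_nonneg_right (by linarith) hb.le
    have e : 12 * x / width β n = 3 * (4 * x / width β n) := by ring
    rw [e]; linarith
  have hp : (3 * |chebArg β L n x|) ^ n ≤ (12 * x / width β n) ^ n := by gcongr
  constructor
  · rw [halfExp_eval, abs_mul, abs_of_pos (Real.exp_pos _)]
    exact mul_le_mul_of_nonneg_left ((abs_truncExp_eval_le_pow hl n hc).trans hp)
      (Real.exp_pos _).le
  · rw [halfExp_derivative_eval, abs_neg, abs_mul, abs_of_pos (by positivity)]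
    have h2 := (abs_truncExp_derivative_eval_le_pow hl n hc).trans
      (mul_le_mul_of_nonneg_left hp (Nat.cast_nonneg n))
    have h3 : 2 / width β n * n ≤ 1 := by
      rw [div_mul_eq_mul_div, div_le_one hb, width]
      nlinarith [Nat.cast_nonneg (α := ℝ) n]
    have hp0 : 0 ≤ (12 * x / width β n) ^ n := le_trans (by positivity) hp
    calc _ ≤ 2 / width β n * Real.exp (β * L / 2) * (n * (12 * x / width β n) ^ n) := by gcongr
      _ = (2 / width β n * n) * (Real.exp (β * L / 2) * (12 * x / width β n) ^ n) := by ring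
      _ ≤ 1 * (Real.exp (β * L / 2) * (12 * x / width β n) ^ n) := by gcongr
      _ = _ := one_mul _

/-! ### Even Taylor polynomials of cosh. -/

/-- The Taylor polynomial of degree `2 N` of `cosh (c x)`. -/
noncomputable def coshTrunc (c : ℝ) (N : ℕ) : ℝ[X] :=
  ∑ j ∈ Finset.range (N + 1), C (c ^ (2 * j) / (2 * j).factorial) * X ^ (2 * j)

lemma coshTrunc_eval (c : ℝ) (N : ℕ) (x : ℝ) :
    (coshTrunc c N).eval x =
      ∑ j ∈ Finset.range (N + 1), (c * x) ^ (2 * j) / (2 * j).factorial := by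
  simp only [coshTrunc, eval_finsetSum, eval_mul, eval_C, eval_pow, eval_X]
  refine Finset.sum_congr rfl fun j _ => ?_
  rw [mul_pow]; ring

lemma coshTrunc_term_nonneg (t : ℝ) (j : ℕ) : 0 ≤ t ^ (2 * j) / ((2 * j).factorial : ℝ) := by
  rw [pow_mul]; positivity

lemma one_le_coshTrunc_eval (c : ℝ) (N : ℕ) (x : ℝ) : 1 ≤ (coshTrunc c N).eval x := by
  rw [coshTrunc_eval]
  simpa using Finset.single_le_sum (fun j _ => coshTrunc_term_nonneg (c * x) j)
    (Finset.mem_range.2 (Nat.succ_pos N))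

lemma term_le_coshTrunc_eval (c : ℝ) (N : ℕ) (x : ℝ) :
    (c * x) ^ (2 * N) / (2 * N).factorial ≤ (coshTrunc c N).eval x := by
  rw [coshTrunc_eval]
  exact Finset.single_le_sum (fun j _ => coshTrunc_term_nonneg (c * x) j)
    (Finset.mem_range.2 (Nat.lt_succ_self N))

lemma coshTrunc_eval_le {c : ℝ} (hc : 0 ≤ c) (N : ℕ) (x : ℝ) :
    (coshTrunc c N).eval x ≤ Real.exp (c * |x|) := by
  rw [coshTrunc_eval]
  refine (sum_le_hasSum _ (fun j _ => coshTrunc_term_nonneg (c * x) j)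
    (Real.hasSum_cosh (c * x))).trans ?_
  rw [← Real.cosh_abs, abs_mul, abs_of_nonneg hc, Real.cosh_eq]
  have : Real.exp (-(c * |x|)) ≤ Real.exp (c * |x|) :=
    Real.exp_le_exp.2 (by linarith [mul_nonneg hc (abs_nonneg x)])
  linarith

/-- An AM-GM inequality between the two neighbouring even terms of the exponential series. -/
lemma odd_term_le (t : ℝ) (N : ℕ) :
    |t| ^ (2 * N + 1) / ((2 * N + 1).factorial : ℝ) ≤
      t ^ (2 * N) / ((2 * N).factorial : ℝ) + t ^ (2 * N + 2) / ((2 * N + 2).factorial : ℝ) := by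
  have e1 : t ^ (2 * N) = |t| ^ (2 * N) := by rw [pow_mul, pow_mul, sq_abs]
  have e2 : t ^ (2 * N + 2) = |t| ^ (2 * N) * |t| ^ 2 := by rw [pow_add, e1, sq_abs]
  rw [e1, e2, Nat.factorial_succ (2 * N + 1), Nat.factorial_succ (2 * N), pow_succ]
  have hA : 0 ≤ |t| ^ (2 * N) / ((2 * N).factorial : ℝ) := by positivity
  push_cast
  have hf : ((2 * N).factorial : ℝ) ≠ 0 := by positivity
  have key : |t| / (2 * N + 1 : ℝ) ≤ 1 + |t| ^ 2 / ((2 * N + 1 + 1) * (2 * N + 1)) := by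
    have hN : (0 : ℝ) ≤ N := Nat.cast_nonneg N
    rw [div_le_iff₀ (by positivity)]
    have : (1 + |t| ^ 2 / ((2 * N + 1 + 1) * (2 * N + 1) : ℝ)) * (2 * N + 1) =
      ((2 * N + 1) * (2 * N + 2) + |t| ^ 2) / (2 * N + 2) := by field_simp; ring
    rw [this, le_div_iff₀ (by positivity)]
    nlinarith [sq_nonneg (|t| - (N + 1)), abs_nonneg t]
  calc _ = |t| ^ (2 * N) / ((2 * N).factorial : ℝ) * (|t| / (2 * N + 1 : ℝ)) := by field_simp
    _ ≤ |t| ^ (2 * N) / ((2 * N).factorial : ℝ) *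
        (1 + |t| ^ 2 / ((2 * N + 1 + 1) * (2 * N + 1))) := mul_le_mul_of_nonneg_left key hA
    _ = _ := by field_simp

lemma coshTrunc_succ (c : ℝ) (N : ℕ) : coshTrunc c (N + 1) =
    coshTrunc c N + C (c ^ (2 * N + 2) / (2 * N + 2).factorial) * X ^ (2 * N + 2) := by
  rw [coshTrunc, Finset.sum_range_succ]; rfl

/-- The extra top term on the left makes the induction close: the new odd term is at most the old
top term, already paid for by the hypothesis, plus the new one, which the right side provides twice.
-/
lemma abs_coshTrunc_derivative_add_le {c : ℝ} (hc : 0 ≤ c) (N : ℕ) (x : ℝ) :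
    |(derivative (coshTrunc c N)).eval x| + c * ((c * x) ^ (2 * N) / (2 * N).factorial)
      ≤ 2 * c * (coshTrunc c N).eval x := by
  induction N with
  | zero => simp [coshTrunc]; linarith
  | succ N ih =>
    have h := odd_term_le (c * x) N
    rw [coshTrunc_succ, derivative_add, eval_add, eval_add]
    have e : (derivative (C (c ^ (2 * N + 2) / ((2 * N + 2).factorial : ℝ)) *
        X ^ (2 * N + 2))).eval x = c * ((c * x) ^ (2 * N + 1) / (2 * N + 1).factorial) := by
      rw [derivative_C_mul, derivative_X_pow]
      simp only [eval_mul, eval_C, eval_pow, eval_X, Nat.factorial_succ (2 * N + 1)]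
      have : ((2 * N + 1).factorial : ℝ) ≠ 0 := by positivity
      push_cast
      field_simp
      ring_nf
    rw [e]
    have h2 : |c * ((c * x) ^ (2 * N + 1) / ((2 * N + 1).factorial : ℝ))| =
        c * (|c * x| ^ (2 * N + 1) / ((2 * N + 1).factorial : ℝ)) := by
      rw [abs_mul, abs_of_nonneg hc, abs_div, abs_pow, Nat.abs_cast]
    have h3 := abs_add_le ((derivative (coshTrunc c N)).eval x)
      (c * ((c * x) ^ (2 * N + 1) / ((2 * N + 1).factorial : ℝ)))
    have h4 := mul_le_mul_of_nonneg_left h hc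
    simp only [eval_mul, eval_C, eval_pow, eval_X]
    rw [show 2 * (N + 1) = 2 * N + 2 by ring]
    have e5 : c ^ (2 * N + 2) / ((2 * N + 2).factorial : ℝ) * x ^ (2 * N + 2) =
      (c * x) ^ (2 * N + 2) / ((2 * N + 2).factorial : ℝ) := by rw [mul_pow]; ring
    rw [e5]
    linarith

lemma abs_coshTrunc_derivative_le {c : ℝ} (hc : 0 ≤ c) (N : ℕ) (x : ℝ) :
    |(derivative (coshTrunc c N)).eval x| ≤ 2 * c * (coshTrunc c N).eval x := by
  have := abs_coshTrunc_derivative_add_le hc N x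
  have := mul_nonneg hc (coshTrunc_term_nonneg (c * x) N)
  linarith

lemma coshTrunc_coeff (c : ℝ) (N k : ℕ) : (coshTrunc c N).coeff k =
    if k ≤ 2 * N ∧ Even k then c ^ k / k.factorial else 0 := by
  simp only [coshTrunc, finsetSum_coeff, coeff_C_mul, coeff_X_pow]
  split_ifs with h
  · obtain ⟨h1, j, hj⟩ := h
    rw [Finset.sum_eq_single j]
    · rw [if_pos (by omega), mul_one, show 2 * j = k by omega]
    · intro b _ hb; rw [if_neg (by omega), mul_zero]
    · intro hj'; rw [Finset.mem_range] at hj'; omega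
  · refine Finset.sum_eq_zero fun j hj => ?_
    rw [Finset.mem_range] at hj
    rw [if_neg, mul_zero]
    rintro rfl
    exact h ⟨by omega, even_two_mul j⟩

/-! ### The flat approximation: positivity, derivative, growth and accuracy. -/

/-- The small weight of the positive correction in `flatExp`. -/
noncomputable def corrWeight (β L : ℝ) : ℝ := Real.exp (-(β * L) - 2 * L) / 4

/-- The flat approximation to `exp (-x)`. -/
noncomputable def flatExp (β L : ℝ) (n : ℕ) : ℝ[X] :=
  C (1 - 4 * corrWeight β L) * halfExp β L n ^ 2 +
    C (corrWeight β L) * coshTrunc (1 / (2 * β)) (n + 1)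

lemma corrWeight_facts {β L : ℝ} {n : ℕ} (h : Admissible β L n) :
    0 < corrWeight β L ∧ 4 * corrWeight β L ≤ 1 / 2 ∧ halfErr β L = corrWeight β L / 8 ∧
      corrWeight β L * Real.exp (β * L) = Real.exp (-2 * L) / 4 := by
  refine ⟨by unfold corrWeight; positivity, ?_, by unfold halfErr corrWeight; ring, ?_⟩
  · have h1 := h.one_le_L
    have h2 := (betaL_facts h).1
    have : Real.exp (-(β * L) - 2 * L) ≤ Real.exp (-1) := Real.exp_le_exp.2 (by linarith)
    have h3 := Real.exp_neg_one_lt_d9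
    unfold corrWeight; linarith
  · rw [corrWeight, div_mul_eq_mul_div, ← Real.exp_add]
    congr 2; ring

/-- Far to the right, the correction dominates the square and its derivative. -/
lemma halfExp_sq_le_correction {β L : ℝ} {n : ℕ} (h : Admissible β L n) {x : ℝ}
    (hx : width β n - β * L ≤ x) {a b : ℝ}
    (ha : |a| ≤ Real.exp (β * L / 2) * (12 * x / width β n) ^ n)
    (hb : |b| ≤ Real.exp (β * L / 2) * (12 * x / width β n) ^ n) :
    |2 * (a * b)| ≤ corrWeight β L * (coshTrunc (1 / (2 * β)) (n + 1)).eval x := by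
  have h1 := h.one_le_beta
  have hw := width_pos h
  have hw4 := four_betaL_le_width h
  have hL := h.one_le_L
  have hK : 0 ≤ β * L := by positivity
  obtain ⟨hLK, -, hn, -⟩ := betaL_facts h
  have hx0 : width β n / 2 ≤ x := by linarith
  have hxp : 0 < x := by linarith
  set t := x / width β n with ht
  have ht2 : 1 / 2 ≤ t := by rw [ht, le_div_iff₀ hw]; linarith
  have e12 : 12 * x / width β n = 12 * t := by rw [ht]; ring
  rw [e12] at ha hb
  -- The top Taylor term alone is kept: x/(2β) = 500t(n+1), and N! ≤ N^N with N = 2(n+1) leaves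
  -- (250t)^N.
  have hS : (250 * t) ^ (2 * (n + 1)) ≤ (coshTrunc (1 / (2 * β)) (n + 1)).eval x := by
    refine le_trans ?_ (term_le_coshTrunc_eval _ _ _)
    rw [le_div_iff₀ (by positivity)]
    have hf : ((2 * (n + 1)).factorial : ℝ) ≤ ((2 * (n + 1) : ℕ) : ℝ) ^ (2 * (n + 1)) := by
      exact_mod_cast Nat.factorial_le_pow _
    calc (250 * t) ^ (2 * (n + 1)) * ((2 * (n + 1)).factorial : ℝ)
        ≤ (250 * t) ^ (2 * (n + 1)) * ((2 * (n + 1) : ℕ) : ℝ) ^ (2 * (n + 1)) := by gcongr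
      _ = (1 / (2 * β) * x) ^ (2 * (n + 1)) := by
        rw [← mul_pow]; congr 1
        rw [ht, width]; push_cast; field_simp; norm_num
  have hab : |2 * (a * b)| ≤ 2 * (Real.exp (β * L) * (12 * t) ^ (2 * n)) := by
    rw [abs_mul, abs_mul, abs_two]
    have : Real.exp (β * L) * (12 * t) ^ (2 * n) =
        (Real.exp (β * L / 2) * (12 * t) ^ n) * (Real.exp (β * L / 2) * (12 * t) ^ n) := by
      rw [show β * L = β * L / 2 + β * L / 2 by ring, Real.exp_add, two_mul n, pow_add]; ring_nf
    rw [this]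
    gcongr
  refine hab.trans (le_trans ?_ (mul_le_mul_of_nonneg_left hS (corrWeight_facts h).1.le))
  have hpow : Real.exp (2 * (β * L) + 2 * L) ≤ (20 : ℝ) ^ (2 * n) := by
    have h20 : Real.exp 1 ≤ 20 := by linarith [Real.exp_one_lt_d9]
    calc Real.exp (2 * (β * L) + 2 * L) ≤ Real.exp ((2 * n : ℕ) * 1) :=
          Real.exp_le_exp.2 (by push_cast; linarith)
      _ = Real.exp 1 ^ (2 * n) := Real.exp_nat_mul _ _
      _ ≤ _ := by gcongr
  -- The slack between 250 and 12 is spent as 20·12 = 240: the factor 20^{2n} swallows e^{2βL+2L},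
  -- the cost of the small weight.
  have h240 : (20 : ℝ) ^ (2 * n) * (12 * t) ^ (2 * n) ≤ (250 * t) ^ (2 * n) := by
    rw [← mul_pow]; exact pow_le_pow_left₀ (by positivity) (by linarith) _
  have hbig : 8 ≤ (250 * t) ^ 2 := by nlinarith
  have hcw : corrWeight β L * Real.exp (2 * (β * L) + 2 * L) = Real.exp (β * L) / 4 := by
    rw [corrWeight, div_mul_eq_mul_div, ← Real.exp_add]; congr 2; ring
  have hpos := (corrWeight_facts h).1
  have e3 : Real.exp (β * L) = corrWeight β L * (4 * Real.exp (2 * (β * L) + 2 * L)) := by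
    linarith
  rw [e3, mul_assoc, mul_left_comm]
  refine mul_le_mul_of_nonneg_left ?_ hpos.le
  rw [mul_add, pow_add, mul_one]
  have hq : 0 ≤ (12 * t) ^ (2 * n) := by positivity
  calc 2 * (4 * Real.exp (2 * (β * L) + 2 * L) * (12 * t) ^ (2 * n))
      ≤ 2 * (4 * (20 : ℝ) ^ (2 * n) * (12 * t) ^ (2 * n)) := by gcongr
    _ = ((20 : ℝ) ^ (2 * n) * (12 * t) ^ (2 * n)) * 8 := by ring
    _ ≤ (250 * t) ^ (2 * n) * (250 * t) ^ 2 := by gcongr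

lemma flatExp_eval (β L : ℝ) (n : ℕ) (x : ℝ) : (flatExp β L n).eval x =
    (1 - 4 * corrWeight β L) * (halfExp β L n).eval x ^ 2 +
      corrWeight β L * (coshTrunc (1 / (2 * β)) (n + 1)).eval x := by
  simp [flatExp]

lemma flatExp_derivative_eval (β L : ℝ) (n : ℕ) (x : ℝ) : (derivative (flatExp β L n)).eval x =
    (1 - 4 * corrWeight β L) *
      (2 * ((halfExp β L n).eval x * (derivative (halfExp β L n)).eval x)) +
      corrWeight β L * (derivative (coshTrunc (1 / (2 * β)) (n + 1))).eval x := by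
  rw [flatExp, derivative_add, derivative_C_mul, derivative_C_mul, pow_two, derivative_mul]
  simp only [eval_add, eval_mul, eval_C]
  ring

lemma flatExp_pos {β L : ℝ} {n : ℕ} (h : Admissible β L n) (x : ℝ) :
    0 < (flatExp β L n).eval x := by
  obtain ⟨h1, h2, -, -⟩ := corrWeight_facts h
  have h3 := one_le_coshTrunc_eval (1 / (2 * β)) (n + 1) x
  rw [flatExp_eval]
  have : 0 ≤ (1 - 4 * corrWeight β L) * (halfExp β L n).eval x ^ 2 :=
    mul_nonneg (by linarith) (sq_nonneg _)
  nlinarith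

/-- Left of the window |q'| ≤ 4q; right of it the cosh term dominates. Inside, with E = e^{-x/2} and
error δ, either E ≥ 2δ, so q ≥ E/2 and q² absorbs qq', or both q and q' are O(δ) and 12δ² ≤ σ. -/
lemma abs_two_mul_halfExp_mul_derivative_le {β L : ℝ} {n : ℕ} (h : Admissible β L n) (x : ℝ) :
    |2 * ((halfExp β L n).eval x * (derivative (halfExp β L n)).eval x)| ≤
      12 * (halfExp β L n).eval x ^ 2 +
        corrWeight β L * (coshTrunc (1 / (2 * β)) (n + 1)).eval x := by
  obtain ⟨h1, h2, h3, -⟩ := corrWeight_facts h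
  have hS := one_le_coshTrunc_eval (1 / (2 * β)) (n + 1) x
  set S := (coshTrunc (1 / (2 * β)) (n + 1)).eval x
  have hcS : corrWeight β L ≤ corrWeight β L * S := by nlinarith
  rcases le_or_gt x (-(β * L)) with hx | hx
  · have hd := abs_halfExp_derivative_le_mul h hx
    have hq := halfExp_eval_nonneg h hx
    rw [abs_mul, abs_mul, abs_two, abs_of_nonneg hq]
    nlinarith
  rcases lt_or_ge x (width β n - β * L) with hx' | hx'
  · have hq := abs_halfExp_sub_le h hx.le hx'.le
    have hd := abs_halfExp_derivative_add_le h hx hx'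
    set q := (halfExp β L n).eval x
    set d := (derivative (halfExp β L n)).eval x
    have hE := Real.exp_pos (-x / 2)
    set E := Real.exp (-x / 2)
    set δ := halfErr β L
    have hδ : 0 < δ := by rw [h3]; linarith
    have hδ2 : 12 * δ ^ 2 ≤ corrWeight β L := by rw [h3]; nlinarith
    have hqa : |q| ≤ E + δ := by
      rw [abs_le] at hq ⊢; constructor <;> linarith
    have hda : |d| ≤ E / 2 + δ := by
      rw [abs_le] at hd ⊢; constructor <;> linarith
    rw [abs_mul, abs_mul, abs_two]
    have hm : |q| * |d| ≤ (E + δ) * (E / 2 + δ) := by gcongr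
    have hq1 : E - δ ≤ q := by linarith [(abs_le.1 hq).1]
    rcases le_total (2 * δ) E with hc | hc
    · have : E / 2 ≤ q := by linarith
      have : E ^ 2 / 4 ≤ q ^ 2 := by nlinarith
      nlinarith
    · nlinarith [sq_nonneg q]
  · have hp := abs_halfExp_le_pow h hx'
    have := halfExp_sq_le_correction h hx' hp.1 hp.2
    nlinarith [sq_nonneg ((halfExp β L n).eval x)]

lemma abs_flatExp_derivative_lt {β L : ℝ} {n : ℕ} (h : Admissible β L n) (x : ℝ) :
    |(derivative (flatExp β L n)).eval x| < 99 * (flatExp β L n).eval x := by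
  obtain ⟨h1, h2, -, -⟩ := corrWeight_facts h
  have hβ := h.one_le_beta
  have h3 := abs_two_mul_halfExp_mul_derivative_le h x
  have hS := one_le_coshTrunc_eval (1 / (2 * β)) (n + 1) x
  have hS' := abs_coshTrunc_derivative_le (c := 1 / (2 * β)) (by positivity) (n + 1) x
  rw [flatExp_eval, flatExp_derivative_eval]
  set S := (coshTrunc (1 / (2 * β)) (n + 1)).eval x
  set S' := (derivative (coshTrunc (1 / (2 * β)) (n + 1))).eval x
  have hb : 2 * (1 / (2 * β)) ≤ 1 := by
    rw [show 2 * (1 / (2 * β)) = 1 / β by field_simp, div_le_one (by linarith)]; exact hβ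
  have hS'' : |S'| ≤ S := hS'.trans (by nlinarith)
  refine (abs_add_le _ _).trans_lt ?_
  rw [abs_mul, abs_mul (corrWeight β L), abs_of_pos h1,
    abs_of_nonneg (show 0 ≤ 1 - 4 * corrWeight β L by linarith)]
  have hσS : 0 < corrWeight β L * S := by positivity
  have ha : (1 - 4 * corrWeight β L) *
      |2 * ((halfExp β L n).eval x * (derivative (halfExp β L n)).eval x)| ≤
      (1 - 4 * corrWeight β L) * (12 * (halfExp β L n).eval x ^ 2 + corrWeight β L * S) :=
    mul_le_mul_of_nonneg_left h3 (by linarith)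
  have hc : (1 - 4 * corrWeight β L) * (corrWeight β L * S) ≤ corrWeight β L * S := by nlinarith
  have hd : 0 ≤ (1 - 4 * corrWeight β L) * (halfExp β L n).eval x ^ 2 :=
    mul_nonneg (by linarith) (sq_nonneg _)
  have he := mul_le_mul_of_nonneg_left hS'' h1.le
  linarith

lemma halfExp_sq_le {β L : ℝ} {n : ℕ} (h : Admissible β L n) {x : ℝ}
    (hx : x ≤ width β n - β * L) :
    (halfExp β L n).eval x ^ 2 ≤ max 1 (Real.exp (-x)) * (1 + 3 * halfErr β L) := by
  obtain ⟨h1, h2, h3, -⟩ := corrWeight_facts h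
  have hδ : 0 < halfErr β L := by rw [h3]; linarith
  have hδ1 : halfErr β L ≤ 1 := by rw [h3]; linarith
  have hEE : Real.exp (-x / 2) ^ 2 = Real.exp (-x) := by
    rw [← Real.exp_nat_mul]; congr 1; push_cast; ring
  have hE := Real.exp_pos (-x / 2)
  rcases le_or_gt x (-(β * L)) with hx' | hx'
  · have hq := halfExp_eval_nonneg h hx'
    have hq' := halfExp_eval_le h hx'
    have hm := le_max_right 1 (Real.exp (-x))
    have : (halfExp β L n).eval x ^ 2 ≤ Real.exp (-x) := by rw [← hEE]; gcongr
    nlinarith [Real.exp_pos (-x)]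
  · have hq := abs_le.1 (abs_halfExp_sub_le h hx'.le hx)
    set q := (halfExp β L n).eval x
    set δ := halfErr β L
    set E := Real.exp (-x / 2)
    rw [← hEE]
    have hq2 : q ^ 2 ≤ (E + δ) ^ 2 := by
      rw [← sq_abs q]
      have : |q| ≤ E + δ := abs_le.2 ⟨by linarith, by linarith⟩
      gcongr
    rcases le_total E 1 with hc | hc
    · rw [max_eq_left (by nlinarith)]; nlinarith
    · rw [max_eq_right (by nlinarith)]
      have h5 : E * δ ≤ E ^ 2 * δ := mul_le_mul_of_nonneg_right (by nlinarith) hδ.le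
      have h6 : δ * δ ≤ E ^ 2 * δ := mul_le_mul_of_nonneg_right (by nlinarith) hδ.le
      nlinarith

/-- The bound has no spare constant, which is why the square carries the factor 1 - 4σ: up to the
right end of the window q² exceeds max(1, e^{-x}) by a factor at most 1 + 3σ/8, and (1-4σ)(1+3σ/8) +
σ ≤ 1. Beyond it q² is at most half of σS. -/
lemma flatExp_growth {β L : ℝ} {n : ℕ} (h : Admissible β L n) (x : ℝ) :
    |(flatExp β L n).eval x| ≤ max 1 (Real.exp (-x)) * Real.exp (1 / β * |x|) := by
  obtain ⟨h1, h2, h3, -⟩ := corrWeight_facts h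
  have hβ := h.one_le_beta
  have hS1 := one_le_coshTrunc_eval (1 / (2 * β)) (n + 1) x
  have hS := coshTrunc_eval_le (c := 1 / (2 * β)) (by positivity) (n + 1) x
  have hS2 : Real.exp (1 / (2 * β) * |x|) ≤ Real.exp (1 / β * |x|) := by
    refine Real.exp_le_exp.2 (mul_le_mul_of_nonneg_right ?_ (abs_nonneg x))
    exact one_div_le_one_div_of_le (by linarith) (by linarith)
  have hF : 1 ≤ Real.exp (1 / β * |x|) := Real.one_le_exp (by positivity)
  have hM := le_max_left 1 (Real.exp (-x))
  rw [abs_of_pos (flatExp_pos h x), flatExp_eval]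
  have hsq := sq_nonneg ((halfExp β L n).eval x)
  set M := max 1 (Real.exp (-x))
  set F := Real.exp (1 / β * |x|)
  set σ := corrWeight β L
  set S := (coshTrunc (1 / (2 * β)) (n + 1)).eval x
  have hMF : 1 ≤ M * F := by nlinarith
  have hSF : σ * S ≤ σ * (M * F) := by
    refine mul_le_mul_of_nonneg_left ?_ h1.le
    nlinarith
  rcases le_total x (width β n - β * L) with hx | hx
  · have hq := halfExp_sq_le h hx
    rw [h3] at hq
    have : M * (1 + 3 * (σ / 8)) ≤ M * F * (1 + 3 * (σ / 8)) :=
      mul_le_mul_of_nonneg_right (by nlinarith) (by linarith)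
    have : (1 - 4 * σ) * (halfExp β L n).eval x ^ 2 ≤
        (1 - 4 * σ) * (M * F * (1 + 3 * (σ / 8))) :=
      mul_le_mul_of_nonneg_left (by linarith) (by linarith)
    have h5 : (1 - 4 * σ) * (M * F * (1 + 3 * (σ / 8))) + σ * (M * F) ≤ M * F := by
      have : (1 - 4 * σ) * (1 + 3 * (σ / 8)) + σ ≤ 1 := by nlinarith
      nlinarith
    linarith
  · have hp := abs_halfExp_le_pow h hx
    have h5 := halfExp_sq_le_correction h hx hp.1 hp.1
    rw [abs_of_nonneg (by nlinarith [sq_nonneg ((halfExp β L n).eval x)])] at h5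
    have h6 : (1 - 4 * σ) * (halfExp β L n).eval x ^ 2 ≤ (halfExp β L n).eval x ^ 2 := by
      nlinarith
    nlinarith

/-- Every error is a small multiple of σe^{βL} = e^{-2L}/4: the error of q², the loss 4σq², and the
added σS. Their combination is below 2e^{-2L} ≤ e^{-L}. -/
lemma abs_flatExp_sub_le {β L : ℝ} {n : ℕ} (h : Admissible β L n) {x : ℝ}
    (hx : x ∈ Set.Icc (-(β * L)) (β * L)) :
    |(flatExp β L n).eval x - Real.exp (-x)| ≤ Real.exp (-L) := by
  obtain ⟨h1, h2, h3, h4⟩ := corrWeight_facts h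
  have hβ := h.one_le_beta
  have hL := h.one_le_L
  have hLK := (betaL_facts h).1
  have hw4 := four_betaL_le_width h
  have hS1 := one_le_coshTrunc_eval (1 / (2 * β)) (n + 1) x
  have hS := coshTrunc_eval_le (c := 1 / (2 * β)) (by positivity) (n + 1) x
  have hxa : |x| ≤ β * L := abs_le.2 hx
  have hS2 : Real.exp (1 / (2 * β) * |x|) ≤ Real.exp (β * L) := by
    refine Real.exp_le_exp.2 ?_
    have : 1 / (2 * β) ≤ 1 := by rw [div_le_one (by positivity)]; linarith
    nlinarith [abs_nonneg x]
  have hEK : Real.exp (-x) ≤ Real.exp (β * L) := Real.exp_le_exp.2 (by linarith [hx.1])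
  have hK1 : 1 ≤ Real.exp (β * L) := Real.one_le_exp (by linarith)
  have hM : max 1 (Real.exp (-x)) ≤ Real.exp (β * L) := max_le hK1 hEK
  have hxw : x ≤ width β n - β * L := by linarith [hx.2]
  have hq2 := halfExp_sq_le h hxw
  have hq := abs_le.1 (abs_halfExp_sub_le h hx.1 hxw)
  have hEE : Real.exp (-x / 2) ^ 2 = Real.exp (-x) := by
    rw [← Real.exp_nat_mul]; congr 1; push_cast; ring
  have hE := Real.exp_pos (-x / 2)
  have hfin : Real.exp (-2 * L) ≤ Real.exp (-L) := Real.exp_le_exp.2 (by linarith)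
  rw [h3] at hq hq2
  rw [flatExp_eval, ← hEE]
  rw [← hEE] at hEK
  set q := (halfExp β L n).eval x
  set E := Real.exp (-x / 2)
  set σ := corrWeight β L
  set S := (coshTrunc (1 / (2 * β)) (n + 1)).eval x
  set K := Real.exp (β * L)
  have hEK' : E ≤ K := by nlinarith
  have hd : |q ^ 2 - E ^ 2| ≤ σ / 2 * K := by
    rw [show q ^ 2 - E ^ 2 = (q - E) * (q + E) by ring, abs_mul]
    have h5 : |q - E| ≤ σ / 8 := abs_le.2 hq
    have h6 : |q + E| ≤ 4 * K := abs_le.2 ⟨by linarith, by linarith⟩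
    calc |q - E| * |q + E| ≤ σ / 8 * (4 * K) := by gcongr
      _ = _ := by ring
  have hd' := abs_le.1 hd
  have hq3 : q ^ 2 ≤ K * 1.1 := by
    refine hq2.trans ?_
    gcongr
    linarith
  have hSK : σ * S ≤ σ * K := mul_le_mul_of_nonneg_left (hS.trans hS2) h1.le
  have hS0 : 0 ≤ σ * S := by positivity
  have hσq : 0 ≤ σ * q ^ 2 := by positivity
  have hσq' : σ * q ^ 2 ≤ σ * (K * 1.1) := mul_le_mul_of_nonneg_left hq3 h1.le
  have hfin2 : Real.exp (-2 * L) * 2 ≤ Real.exp (-L) := by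
    have e : Real.exp (-2 * L) = Real.exp (-L) * Real.exp (-L) := by
      rw [← Real.exp_add]; congr 1; ring
    have : Real.exp (-L) ≤ 1 / 2 := by
      have h7 : Real.exp (-L) ≤ Real.exp (-1) := Real.exp_le_exp.2 (by linarith)
      linarith [Real.exp_neg_one_lt_d9]
    rw [e]; nlinarith [Real.exp_pos (-L)]
  rw [abs_le]
  constructor <;> nlinarith

/-! ### Coefficients, degree and roots of the flat approximation. -/

open Polynomial.Chebyshev

lemma abs_coeff_linear_mul_le {a c N M : ℝ} (hN : |a| + |c| ≤ N) {p : ℝ[X]}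
    (hp : ∀ k, |p.coeff k| ≤ M) (k : ℕ) : |((C c - C a * X) * p).coeff k| ≤ N * M := by
  have hM : 0 ≤ M := (abs_nonneg _).trans (hp 0)
  have key : |((C c - C a * X) * p).coeff k| ≤ |c| * M + |a| * M := by
    rw [sub_mul, mul_assoc, coeff_sub, coeff_C_mul, coeff_C_mul]
    refine (abs_sub _ _).trans ?_
    rw [abs_mul, abs_mul]
    refine add_le_add (mul_le_mul_of_nonneg_left (hp k) (abs_nonneg _))
      (mul_le_mul_of_nonneg_left ?_ (abs_nonneg _))
    rcases k with _ | k
    · simpa using hM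
    · rw [coeff_X_mul]; exact hp k
  nlinarith

/-- The recursion costs 2·2·5 + 1 = 21 ≤ 25 = 5². -/
lemma abs_coeff_T_comp_le {a c : ℝ} (h : |a| + |c| ≤ 2) (n k : ℕ) :
    |((T ℝ n).comp (C c - C a * X)).coeff k| ≤ 5 ^ n := by
  induction n using Nat.twoStepInduction generalizing k with
  | zero =>
    simp only [Nat.cast_zero, T_zero, one_comp, coeff_one, pow_zero]
    split_ifs <;> simp
  | one =>
    have h1 : ∀ k, |(1 : ℝ[X]).coeff k| ≤ 1 := fun k => by
      rw [coeff_one]; split_ifs <;> simp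
    have := abs_coeff_linear_mul_le h h1 k
    rw [mul_one] at this
    simp only [Nat.cast_one, T_one, X_comp]
    linarith
  | more n ih1 ih2 =>
    have e : (T ℝ ((n + 2 : ℕ) : ℤ)).comp (C c - C a * X) =
        C 2 * ((C c - C a * X) * (T ℝ ((n + 1 : ℕ) : ℤ)).comp (C c - C a * X)) -
          (T ℝ n).comp (C c - C a * X) := by
      push_cast
      rw [T_add_two, sub_comp, mul_comp, mul_comp, X_comp, mul_assoc,
        show (2 : ℝ[X]) = Polynomial.C 2 from (map_ofNat Polynomial.C 2).symm, C_comp]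
    rw [e, coeff_sub, coeff_C_mul]
    refine (abs_sub _ _).trans ?_
    rw [abs_mul, abs_two]
    have h1 := abs_coeff_linear_mul_le h ih2 k
    have h2 := ih1 k
    have h3 : (0 : ℝ) ≤ 5 ^ n := by positivity
    rw [pow_succ] at h1 ⊢
    rw [pow_succ]
    nlinarith

lemma abs_coeff_truncExp_comp_le {lam : ℝ} (hl : 0 ≤ lam) {a c : ℝ} (h : |a| + |c| ≤ 2)
    (n k : ℕ) : |((truncExp lam n).comp (C c - C a * X)).coeff k| ≤ 5 ^ n := by
  have e : ((truncExp lam n).comp (C c - C a * X)).coeff k =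
      ∑ m ∈ Finset.Icc (-n : ℤ) n,
        (∑' p, if pairDiff p = m then poissonPair lam p else 0) *
          ((T ℝ m).comp (C c - C a * X)).coeff k := by
    simp only [truncExp, Polynomial.sum_comp, finsetSum_coeff, mul_comp, C_comp, coeff_C_mul]
  rw [e, sum_coeff_mul_eq_tsum hl n fun m => ((T ℝ m).comp (C c - C a * X)).coeff k]
  refine abs_tsum_ite_le hl n (f := fun m => ((T ℝ m).comp (C c - C a * X)).coeff k)
    (by positivity) fun m hm => ?_
  rw [← T_natAbs]
  rw [Int.abs_eq_natAbs] at hm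
  exact (abs_coeff_T_comp_le h _ k).trans (pow_le_pow_right₀ (by norm_num) (by omega))

lemma abs_coeff_halfExp_le {β L : ℝ} {n : ℕ} (h : Admissible β L n) (k : ℕ) :
    |(halfExp β L n).coeff k| ≤ Real.exp (β * L / 2) * 5 ^ n := by
  have hw := width_pos h
  have hw4 := four_betaL_le_width h
  have h1 := h.one_le_beta
  have hL := h.one_le_L
  have hK : 1 ≤ β * L := (betaL_facts h).1.trans' hL
  rw [halfExp, coeff_C_mul, abs_mul, abs_of_pos (Real.exp_pos _)]
  refine mul_le_mul_of_nonneg_left (abs_coeff_truncExp_comp_le (by positivity) ?_ n k)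
    (Real.exp_pos _).le
  have e1 : 2 * (β * L) / width β n ≤ 1 := by rw [div_le_one hw]; linarith
  have e2 : 2 / width β n ≤ 1 := by rw [div_le_one hw]; linarith
  have e3 : 0 ≤ 2 * (β * L) / width β n := by positivity
  rw [abs_of_pos (show 0 < 2 / width β n by positivity), abs_of_nonneg (by linarith)]
  linarith

lemma natDegree_halfExp_le (β L : ℝ) (n : ℕ) : (halfExp β L n).natDegree ≤ n := by
  refine (natDegree_C_mul_le _ _).trans ?_
  rw [natDegree_comp]
  have h1 := natDegree_truncExp_le (width β n / 4) n
  have h2 : (C (1 - 2 * (β * L) / width β n) - C (2 / width β n) * X).natDegree ≤ 1 := by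
    compute_degree
  nlinarith

lemma abs_coeff_sq_le {p : ℝ[X]} {n : ℕ} {M : ℝ} (hd : p.natDegree ≤ n)
    (hp : ∀ k, |p.coeff k| ≤ M) (k : ℕ) : |(p ^ 2).coeff k| ≤ (2 * n + 1) * M ^ 2 := by
  have hM : 0 ≤ M := (abs_nonneg _).trans (hp 0)
  rcases le_or_gt k (2 * n) with hk | hk
  · rw [pow_two, coeff_mul]
    refine (Finset.abs_sum_le_sum_abs _ _).trans ?_
    have : ∀ x ∈ Finset.HasAntidiagonal.antidiagonal k, |p.coeff x.1 * p.coeff x.2| ≤ M ^ 2 := fun x _ => by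
      rw [abs_mul, pow_two]
      exact mul_le_mul (hp _) (hp _) (abs_nonneg _) hM
    refine (Finset.sum_le_card_nsmul _ _ _ this).trans ?_
    rw [Finset.Nat.card_antidiagonal, nsmul_eq_mul]
    have : (k : ℝ) ≤ 2 * n := by exact_mod_cast hk
    push_cast
    gcongr
  · rw [coeff_eq_zero_of_natDegree_lt, abs_zero]
    · positivity
    · exact (natDegree_pow_le.trans (by omega : 2 * p.natDegree ≤ 2 * n)).trans_lt hk

lemma natDegree_coshTrunc_le (c : ℝ) (N : ℕ) : (coshTrunc c N).natDegree ≤ 2 * N := by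
  rw [natDegree_le_iff_coeff_eq_zero]
  intro k hk
  rw [coshTrunc_coeff, if_neg (by omega)]

/-- The square has degree at most 2n, so taking the Taylor polynomial one step further, to degree
2(n+1), leaves an explicit positive leading coefficient. -/
lemma flatExp_coeff_top {β L : ℝ} {n : ℕ} : (flatExp β L n).coeff (2 * (n + 1)) =
    corrWeight β L * ((1 / (2 * β)) ^ (2 * (n + 1)) / (2 * (n + 1)).factorial) := by
  have h1 : (halfExp β L n ^ 2).coeff (2 * (n + 1)) = 0 := by
    refine coeff_eq_zero_of_natDegree_lt (natDegree_pow_le.trans_lt ?_)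
    have := natDegree_halfExp_le β L n
    omega
  rw [flatExp, coeff_add, coeff_C_mul, coeff_C_mul, h1, coshTrunc_coeff,
    if_pos ⟨le_rfl, even_two_mul _⟩, mul_zero, zero_add]

lemma natDegree_flatExp {β L : ℝ} {n : ℕ} (h : Admissible β L n) :
    (flatExp β L n).natDegree = 2 * (n + 1) := by
  refine le_antisymm ?_ (le_natDegree_of_ne_zero ?_)
  · refine natDegree_add_le_of_degree_le ?_ ?_
    · refine (natDegree_C_mul_le _ _).trans (natDegree_pow_le.trans ?_)
      have := natDegree_halfExp_le β L n
      omega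
    · exact (natDegree_C_mul_le _ _).trans (natDegree_coshTrunc_le _ _)
  · rw [flatExp_coeff_top]
    have := (corrWeight_facts h).1
    have := h.one_le_beta
    positivity

lemma abs_coeff_flatExp_le {β L : ℝ} {n : ℕ} (h : Admissible β L n) (k : ℕ) :
    |(flatExp β L n).coeff k| ≤ (2 * n + 2) * (Real.exp (β * L) * 25 ^ n) := by
  obtain ⟨h1, h2, -, -⟩ := corrWeight_facts h
  have hβ := h.one_le_beta
  have hq := abs_coeff_sq_le (natDegree_halfExp_le β L n) (abs_coeff_halfExp_le h) k
  have e : (Real.exp (β * L / 2) * 5 ^ n) ^ 2 = Real.exp (β * L) * 25 ^ n := by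
    rw [mul_pow, ← Real.exp_nat_mul, ← pow_mul, mul_comm n 2, pow_mul]; norm_num
    ring_nf
  rw [e] at hq
  have hc : |(coshTrunc (1 / (2 * β)) (n + 1)).coeff k| ≤ 1 := by
    rw [coshTrunc_coeff]
    split_ifs
    · have h3 : 1 / (2 * β) ≤ 1 := by rw [div_le_one (by positivity)]; linarith
      have h4 : (1 / (2 * β)) ^ k ≤ 1 := pow_le_one₀ (by positivity) h3
      rw [abs_of_nonneg (by positivity), div_le_one (by positivity)]
      refine h4.trans ?_
      exact_mod_cast Nat.one_le_iff_ne_zero.2 k.factorial_ne_zero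
    · simp
  have hK : 1 ≤ Real.exp (β * L) * 25 ^ n := by
    have h5 : 1 ≤ Real.exp (β * L) := Real.one_le_exp (by have := h.one_le_L; positivity)
    have h6 : (1 : ℝ) ≤ 25 ^ n := one_le_pow₀ (by norm_num)
    nlinarith
  rw [flatExp, coeff_add, coeff_C_mul, coeff_C_mul]
  refine (abs_add_le _ _).trans ?_
  rw [abs_mul, abs_mul, abs_of_pos h1, abs_of_nonneg (by linarith)]
  set Z := Real.exp (β * L) * 25 ^ n
  have h7 : (1 - 4 * corrWeight β L) * |(halfExp β L n ^ 2).coeff k| ≤ 1 * ((2 * n + 1) * Z) := by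
    gcongr
    linarith
  have h8 : corrWeight β L * |(coshTrunc (1 / (2 * β)) (n + 1)).coeff k| ≤ 1 * 1 := by
    gcongr
    linarith
  linarith

/-- Differentiation does not affect the top coefficient, so Cauchy's root bound applies with leading
coefficient 99 times that of P. The two signs are s = 1 and s = -1. -/
lemma hasLeadingCoeffAndRootsBound_of_coeff_le {P : ℝ[X]} {M A s : ℝ} (hs : |s| ≤ 1)
    (hd : 0 < P.natDegree) (hlc : 0 < P.leadingCoeff) (hlc' : 99 * P.leadingCoeff ≤ 1)
    (hM : ∀ k, |P.coeff k| ≤ M) (hA : (99 + P.natDegree) * M / P.leadingCoeff + 1 ≤ A) :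
    HasLeadingCoeffAndRootsBound A (C 99 * P + C s * derivative P) := by
  set N := P.natDegree with hN
  have hM0 : 0 ≤ M := (abs_nonneg _).trans (hM 0)
  set p := C 99 * P + C s * derivative P with hp
  have hcN : p.coeff N = 99 * P.leadingCoeff := by
    rw [hp, coeff_add, coeff_C_mul, coeff_C_mul, coeff_derivative,
      coeff_eq_zero_of_natDegree_lt (Nat.lt_succ_self _), zero_mul, mul_zero, add_zero]
    rfl
  have hdeg : p.natDegree = N := by
    refine le_antisymm ?_ (le_natDegree_of_ne_zero (by rw [hcN]; positivity))
    refine natDegree_add_le_of_degree_le (natDegree_C_mul_le _ _) ?_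
    exact (natDegree_C_mul_le _ _).trans ((natDegree_derivative_le P).trans (Nat.sub_le _ _))
  have hplc : p.leadingCoeff = 99 * P.leadingCoeff := by rw [leadingCoeff, hdeg, hcN]
  have hcoef : ∀ k, |p.coeff k| ≤ (99 + N) * M := by
    intro k
    rw [hp, coeff_add, coeff_C_mul, coeff_C_mul]
    refine (abs_add_le _ _).trans ?_
    have h1 : |99 * P.coeff k| ≤ 99 * M := by
      rw [abs_mul, abs_of_pos (by norm_num : (0 : ℝ) < 99)]
      exact mul_le_mul_of_nonneg_left (hM k) (by norm_num)
    have h2 : |s * (derivative P).coeff k| ≤ N * M := by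
      rw [abs_mul, coeff_derivative, abs_mul]
      rcases lt_or_ge N (k + 1) with hk | hk
      · rw [coeff_eq_zero_of_natDegree_lt hk]; simp; positivity
      · have h3 : |(k : ℝ) + 1| ≤ N := by
          rw [abs_of_nonneg (by positivity)]; exact_mod_cast hk
        calc |s| * (|P.coeff (k + 1)| * |(k : ℝ) + 1|) ≤ 1 * (M * N) := by
              gcongr; exact hM _
          _ = _ := by ring
    linarith
  refine ⟨by rw [hplc]; positivity, by rw [hplc]; exact hlc', fun z hz => ?_⟩
  have hp0 : p ≠ 0 := fun h0 => by rw [h0, leadingCoeff_zero] at hplc; linarith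
  set p' := p.map (algebraMap ℝ ℂ)
  have hp' : p' ≠ 0 := (Polynomial.map_ne_zero_iff (algebraMap ℝ ℂ).injective).2 hp0
  have hroot : p'.IsRoot z := by
    rw [IsRoot.def, eval_map_algebraMap]; exact hz
  have hb := IsRoot.norm_lt_cauchyBound hp' hroot
  have hb' : ‖z‖ < (cauchyBound p' : ℝ) := by exact_mod_cast hb
  refine hb'.le.trans (le_trans ?_ hA)
  rw [cauchyBound]
  push_cast
  have hlcC : ‖p'.leadingCoeff‖ = 99 * P.leadingCoeff := by
    rw [leadingCoeff_map, hplc, norm_algebraMap', Real.norm_eq_abs, abs_of_pos (by positivity)]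
  have hsup : (((Finset.range p'.natDegree).sup (‖p'.coeff ·‖₊) : NNReal) : ℝ) ≤
      (99 + N) * M := by
    have h0 : 0 ≤ (99 + N) * M := by positivity
    have : (Finset.range p'.natDegree).sup (‖p'.coeff ·‖₊) ≤ Real.toNNReal ((99 + N) * M) := by
      refine Finset.sup_le fun k _ => NNReal.coe_le_coe.1 ?_
      rw [coe_nnnorm, Real.coe_toNNReal _ h0, coeff_map, norm_algebraMap', Real.norm_eq_abs]
      exact hcoef k
    have := NNReal.coe_le_coe.2 this
    rwa [Real.coe_toNNReal _ h0] at this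
  rw [hlcC]
  refine add_le_add (div_le_div₀ (by positivity) hsup hlc (by linarith)) le_rfl

/-- The dominant factor is the inverse leading coefficient (2β)^N N! with N = 2(n+1). Since 2βN ≤
e^{28βL}, it contributes N·28βL, of order β³L²; every other factor has a smaller exponent. -/
lemma root_exponent_le {β L : ℝ} {n : ℕ} (h : Admissible β L n) :
    (99 + (2 * (n + 1) : ℕ)) * ((2 * n + 2) * (Real.exp (β * L) * 25 ^ n)) /
      (corrWeight β L * ((1 / (2 * β)) ^ (2 * (n + 1)) / (2 * (n + 1)).factorial)) + 1
      ≤ Real.exp (10 ^ 14 * β ^ 3 * L ^ 2) := by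
  have hβ := h.one_le_beta
  have hL := h.one_le_L
  have hn := h.n_le
  obtain ⟨h1, -, h2, h3⟩ := betaL_facts h
  have hK : 1 ≤ β * L := by linarith
  have e25 : (25 : ℝ) ^ n ≤ Real.exp (4 * n) := by
    rw [mul_comm, Real.exp_nat_mul]
    gcongr
    calc (25 : ℝ) ≤ 2.7 ^ 4 := by norm_num
      _ ≤ Real.exp 1 ^ 4 := by gcongr; linarith [Real.exp_one_gt_d9]
      _ = Real.exp 4 := by rw [← Real.exp_nat_mul]; norm_num
  have e1 : (99 + (2 * (n + 1) : ℕ) : ℝ) ≤ Real.exp (2 * n + 101) := by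
    have := Real.add_one_le_exp (2 * n + 101 : ℝ); push_cast; linarith
  have e2 : (2 * n + 2 : ℝ) ≤ Real.exp (2 * n + 2) := by
    have := Real.add_one_le_exp (2 * n + 2 : ℝ); linarith
  have e4 : (4 : ℝ) ≤ Real.exp 4 := by linarith [Real.add_one_le_exp (4 : ℝ)]
  have ebase : 2 * β * (2 * (n + 1) : ℕ) ≤ Real.exp (28 * (β * L)) := by
    have f1 : β ≤ Real.exp β := by linarith [Real.add_one_le_exp β]
    have f2 : L ≤ Real.exp L := by linarith [Real.add_one_le_exp L]
    have f3 : (16 * 10 ^ 6 : ℝ) ≤ Real.exp 24 := by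
      calc (16 * 10 ^ 6 : ℝ) ≤ 2 ^ 24 := by norm_num
        _ ≤ Real.exp 1 ^ 24 := by gcongr; linarith [Real.exp_one_gt_d9]
        _ = Real.exp 24 := by rw [← Real.exp_nat_mul]; norm_num
    have f4 : 2 * β * (2 * (n + 1) : ℕ) ≤ 16 * 10 ^ 6 * (β ^ 3 * L) := by
      have : (n + 1 : ℝ) ≤ 2 * n := by linarith
      have g1 : β * (n + 1 : ℝ) ≤ β * (2 * n) := by gcongr
      have g2 : β * (n : ℝ) ≤ β * (2 * 10 ^ 6 * β ^ 2 * L) := by gcongr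
      push_cast
      nlinarith
    refine f4.trans ?_
    calc 16 * 10 ^ 6 * (β ^ 3 * L) ≤ Real.exp 24 * (Real.exp β ^ 3 * Real.exp L) := by gcongr
      _ = Real.exp (24 + (3 * β + L)) := by
        rw [← Real.exp_nat_mul, ← Real.exp_add, ← Real.exp_add]; norm_num
      _ ≤ _ := Real.exp_le_exp.2 (by nlinarith)
  have efac : (2 * β) ^ (2 * (n + 1)) * ((2 * (n + 1)).factorial : ℝ) ≤
      Real.exp ((2 * (n + 1) : ℕ) * (28 * (β * L))) := by
    have : ((2 * (n + 1)).factorial : ℝ) ≤ ((2 * (n + 1) : ℕ) : ℝ) ^ (2 * (n + 1)) := by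
      exact_mod_cast Nat.factorial_le_pow _
    calc _ ≤ (2 * β) ^ (2 * (n + 1)) * ((2 * (n + 1) : ℕ) : ℝ) ^ (2 * (n + 1)) := by gcongr
      _ = (2 * β * (2 * (n + 1) : ℕ)) ^ (2 * (n + 1)) := (mul_pow _ _ _).symm
      _ ≤ Real.exp (28 * (β * L)) ^ (2 * (n + 1)) := by gcongr
      _ = _ := by rw [← Real.exp_nat_mul]
  have einv : (corrWeight β L * ((1 / (2 * β)) ^ (2 * (n + 1)) / (2 * (n + 1)).factorial))⁻¹ =
      4 * Real.exp (β * L + 2 * L) *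
        ((2 * β) ^ (2 * (n + 1)) * ((2 * (n + 1)).factorial : ℝ)) := by
    rw [corrWeight, show -(β * L) - 2 * L = -(β * L + 2 * L) by ring, Real.exp_neg, one_div,
      inv_pow]
    field_simp
  rw [div_eq_mul_inv, einv]
  set D := (2 * (n + 1) : ℕ) * (28 * (β * L))
  set e := (2 * n + 101) + ((2 * n + 2) + (β * L + 4 * n)) + (4 + (β * L + 2 * L) + D) with he
  have hmain : (99 + (2 * (n + 1) : ℕ)) * ((2 * n + 2) * (Real.exp (β * L) * 25 ^ n)) *
      (4 * Real.exp (β * L + 2 * L) * ((2 * β) ^ (2 * (n + 1)) * ((2 * (n + 1)).factorial : ℝ)))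
      ≤ Real.exp e := by
    rw [he]
    rw [Real.exp_add (2 * (n : ℝ) + 101 + (2 * n + 2 + (β * L + 4 * n))),
      Real.exp_add (2 * (n : ℝ) + 101), Real.exp_add (2 * (n : ℝ) + 2),
      Real.exp_add (β * L) (4 * n), Real.exp_add _ D, Real.exp_add 4]
    gcongr
  have hone : 1 ≤ Real.exp e := Real.one_le_exp (by
    have : 0 ≤ D := by positivity
    positivity)
  have hb3 : β ^ 2 * L ≤ β ^ 3 * L ^ 2 := by
    have : β ^ 3 * L ^ 2 = β ^ 2 * L * (β * L) := by ring
    rw [this]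
    exact le_mul_of_one_le_right (by positivity) hK
  have hD : D ≤ 224 * 10 ^ 6 * (β ^ 3 * L ^ 2) := by
    have : ((2 * (n + 1) : ℕ) : ℝ) ≤ 8 * 10 ^ 6 * β ^ 2 * L := by push_cast; linarith
    calc D ≤ 8 * 10 ^ 6 * β ^ 2 * L * (28 * (β * L)) :=
          mul_le_mul_of_nonneg_right this (by positivity)
      _ = _ := by ring
  calc _ ≤ Real.exp e + Real.exp e := add_le_add hmain hone
    _ = 2 * Real.exp e := by ring
    _ ≤ Real.exp 1 * Real.exp e := by gcongr; linarith [Real.exp_one_gt_d9]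
    _ = Real.exp (1 + e) := by rw [← Real.exp_add]
    _ ≤ _ := Real.exp_le_exp.2 (by rw [he]; linarith)

lemma flatExp_bound {β L s : ℝ} {n : ℕ} (h : Admissible β L n) (hs : |s| ≤ 1) :
    HasLeadingCoeffAndRootsBound (Real.exp (10 ^ 14 * β ^ 3 * L ^ 2))
      (C 99 * flatExp β L n + C s * derivative (flatExp β L n)) := by
  have hβ := h.one_le_beta
  have hd := natDegree_flatExp h
  obtain ⟨h1, h2, -, -⟩ := corrWeight_facts h
  have hlc : (flatExp β L n).leadingCoeff =
      corrWeight β L * ((1 / (2 * β)) ^ (2 * (n + 1)) / (2 * (n + 1)).factorial) := by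
    rw [leadingCoeff, hd, flatExp_coeff_top]
  refine hasLeadingCoeffAndRootsBound_of_coeff_le hs (by omega) ?_ ?_ (abs_coeff_flatExp_le h) ?_
  · rw [hlc]; positivity
  · rw [hlc]
    obtain ⟨-, -, -, hn⟩ := betaL_facts h
    have hf : ((2 * (n + 1) : ℕ) : ℝ) ≤ ((2 * (n + 1)).factorial : ℝ) := by
      exact_mod_cast Nat.self_le_factorial _
    have h3 : 1 / (2 * β) ≤ 1 := by rw [div_le_one (by positivity)]; linarith
    have h4 : (1 / (2 * β)) ^ (2 * (n + 1)) ≤ 1 := pow_le_one₀ (by positivity) h3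
    have h5 : (1 / (2 * β)) ^ (2 * (n + 1)) / ((2 * (n + 1)).factorial : ℝ) ≤ 1 / 99 := by
      refine div_le_div₀ (by norm_num) h4 (by norm_num) ?_
      push_cast at hf
      linarith
    nlinarith
  · rw [hlc, hd]
    exact root_exponent_le h

theorem exists_isGoodFlatPolynomial {β ε : ℝ} (hβ : 1 ≤ β) (hε : 0 < ε)
    (hL : 1 ≤ Real.log (1 / ε)) : ∃ P : ℝ[X], IsGoodFlatPolynomial β ε P := by
  set L := Real.log (1 / ε) with hLdef
  have hεL : Real.exp (-L) = ε := by
    rw [hLdef, one_div, Real.log_inv, neg_neg, Real.exp_log hε]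
  set n := ⌈10 ^ 6 * β ^ 2 * L⌉₊
  have h0 : 1 ≤ β ^ 2 * L := by nlinarith
  have hn2 : (n : ℝ) < 10 ^ 6 * β ^ 2 * L + 1 := Nat.ceil_lt_add_one (by positivity)
  have h : Admissible β L n := ⟨hβ, hL, Nat.le_ceil _, by linarith⟩
  refine ⟨flatExp β L n, ?_, ⟨fun x hx => ?_, flatExp_growth h⟩, flatExp_pos h,
    abs_flatExp_derivative_lt h, ?_, ?_⟩
  · rw [natDegree_flatExp h]
    push_cast
    linarith
  · exact (abs_flatExp_sub_le h hx).trans hεL.le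
  · have := flatExp_bound h (s := 1) (by simp)
    rwa [map_one, one_mul] at this
  · have := flatExp_bound h (s := -1) (by simp)
    rwa [map_neg, map_one, neg_one_mul, ← sub_eq_add_neg] at this

end FlatExp

/-! ### Positive univariate polynomials as sums of two squares. -/

namespace Polynomial

lemma abs_coeff_X_sub_C_mul_add_le {p q : ℝ[X]} {r t A M : ℝ} (hr : |r| ≤ A) (ht : |t| ≤ A)
    (hp : ∀ k, |p.coeff k| ≤ M) (hq : ∀ k, |q.coeff k| ≤ M) (k : ℕ) :
    |((X - C r) * p + C t * q).coeff k| ≤ (1 + 2 * A) * M := by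
  have hM : 0 ≤ M := (abs_nonneg _).trans (hp 0)
  rw [sub_mul, coeff_add, coeff_sub, coeff_C_mul, coeff_C_mul]
  refine (abs_add_le _ _).trans ((add_le_add (abs_sub _ _) le_rfl).trans ?_)
  rw [abs_mul, abs_mul]
  have h1 : |(X * p).coeff k| ≤ M := by
    rcases k with _ | k
    · simpa using hM
    · rw [coeff_X_mul]; exact hp k
  have h2 : |r| * |p.coeff k| ≤ A * M :=
    mul_le_mul hr (hp k) (abs_nonneg _) ((abs_nonneg _).trans hr)
  have h3 : |t| * |q.coeff k| ≤ A * M :=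
    mul_le_mul ht (hq k) (abs_nonneg _) ((abs_nonneg _).trans hr)
  linarith

/-- A positive polynomial with roots bounded by `A` is a sum of two squares, up to its leading
coefficient, of polynomials with coefficients bounded in terms of `A`. -/
theorem exists_sum_two_sq_of_pos {A : ℝ} (p : ℝ[X]) (hpos : ∀ x, 0 < p.eval x)
    (hroots : ∀ z : ℂ, aeval z p = 0 → ‖z‖ ≤ A) :
    ∃ (h : ℕ) (a b : ℝ[X]), p.natDegree = 2 * h ∧ a.natDegree ≤ h ∧ b.natDegree ≤ h ∧
      (∀ k, |a.coeff k| ≤ (1 + 2 * A) ^ h) ∧ (∀ k, |b.coeff k| ≤ (1 + 2 * A) ^ h) ∧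
      p = C p.leadingCoeff * (a ^ 2 + b ^ 2) := by
  induction hn : p.natDegree using Nat.strong_induction_on generalizing p with
  | _ n ih =>
  subst hn
  have hp0 : p ≠ 0 := by rintro rfl; simpa using hpos 0
  rcases Nat.eq_zero_or_pos p.natDegree with h0 | h0
  · refine ⟨0, 1, 0, by omega, by simp, by simp, fun k => ?_, fun k => by simp, ?_⟩
    · rw [coeff_one]; split_ifs <;> simp
    · rw [eq_C_of_natDegree_eq_zero h0]; simp
  have hdeg : p.degree ≠ 0 := by
    rw [degree_eq_natDegree hp0]; exact_mod_cast h0.ne'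
  obtain ⟨z, hz⟩ := IsAlgClosed.exists_aeval_eq_zero ℂ p hdeg
  -- Positivity on the real line excludes real roots, so z and its conjugate split off the quadratic
  -- (X - Re z)² + (Im z)², and induction applies to the quotient.
  have him : z.im ≠ 0 := by
    intro him
    have e : z = algebraMap ℝ ℂ z.re := Complex.ext (by simp) (by simp [him])
    rw [e, aeval_algebraMap_apply] at hz
    have := hpos z.re
    rw [coe_aeval_eq_eval] at hz
    have hz' : p.eval z.re = 0 := by
      simpa using hz
    linarith
  obtain ⟨q, hq⟩ := quadratic_dvd_of_aeval_eq_zero_im_ne_zero p hz him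
  have hnorm : ‖z‖ ^ 2 = z.re ^ 2 + z.im ^ 2 := by
    rw [Complex.sq_norm, Complex.normSq_apply]; ring
  set Q : ℝ[X] := X ^ 2 - C (2 * z.re) * X + C (‖z‖ ^ 2) with hQdef
  have hQ : Q = (X - C z.re) ^ 2 + C z.im ^ 2 := by
    rw [hQdef, hnorm]
    simp only [map_add, map_mul, map_pow, map_ofNat]
    ring
  have hQm : Q.Monic := by rw [hQdef]; monicity!
  have hQd : Q.natDegree = 2 := by rw [hQdef]; compute_degree!
  have hQpos : ∀ x, 0 < Q.eval x := fun x => by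
    rw [hQ]
    simp only [eval_add, eval_pow, eval_sub, eval_X, eval_C]
    have : 0 < z.im ^ 2 := by positivity
    positivity
  have hqpos : ∀ x, 0 < q.eval x := fun x => by
    have := hpos x
    rw [hq, eval_mul] at this
    exact (pos_iff_pos_of_mul_pos this).1 (hQpos x)
  have hq0 : q ≠ 0 := by rintro rfl; simpa using hqpos 0
  have hd : p.natDegree = 2 + q.natDegree := by
    rw [hq, natDegree_mul hQm.ne_zero hq0, hQd]
  have hlc : p.leadingCoeff = q.leadingCoeff := by
    rw [hq, leadingCoeff_mul, hQm.leadingCoeff, one_mul]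
  obtain ⟨h, a, b, h1, h2, h3, h4, h5, h6⟩ := ih q.natDegree (by omega) q hqpos
    (fun w hw => hroots w (by rw [hq, map_mul, hw, mul_zero])) rfl
  have hzA := hroots z hz
  have hre : |z.re| ≤ A := (Complex.abs_re_le_norm z).trans hzA
  have him' : |z.im| ≤ A := (Complex.abs_im_le_norm z).trans hzA
  have hdeg' : ∀ (f g : ℝ[X]) (t : ℝ), f.natDegree ≤ h → g.natDegree ≤ h →
      ((X - C z.re) * f + C t * g).natDegree ≤ h + 1 := by
    intro f g t hf hg
    refine natDegree_add_le_of_degree_le ?_ ((natDegree_C_mul_le _ _).trans (by omega))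
    refine natDegree_mul_le.trans ?_
    rw [natDegree_X_sub_C]; omega
  -- Multiplicativity of the complex norm: (u²+v²)(a²+b²) = (ua+vb)² + (ub-va)² with u = X - Re z
  -- and v = Im z. Each step multiplies the coefficient bound by 1 + 2A.
  refine ⟨h + 1, (X - C z.re) * a + C z.im * b, (X - C z.re) * b + C (-z.im) * a, by omega,
    hdeg' _ _ _ h2 h3, hdeg' _ _ _ h3 h2, fun k => ?_, fun k => ?_, ?_⟩
  · rw [pow_succ']
    exact abs_coeff_X_sub_C_mul_add_le hre him' h4 h5 k
  · rw [pow_succ']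
    exact abs_coeff_X_sub_C_mul_add_le hre (by rwa [abs_neg]) h5 h4 k
  · rw [hlc]
    nth_rewrite 1 [hq]
    nth_rewrite 1 [h6]
    rw [hQ, map_neg]
    ring

end Polynomial

/-! ### The submultiplicative ℓ¹ norm of coefficients. -/

namespace MvPolynomial

variable {σ : Type*}

/-- The sum of the absolute values of the coefficients. -/
noncomputable def coeffNorm (p : MvPolynomial σ ℝ) : ℝ := ∑ m ∈ p.support, |p.coeff m|

lemma coeffNorm_eq_sum {p : MvPolynomial σ ℝ} {s : Finset (σ →₀ ℕ)} (hs : p.support ⊆ s) :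
    coeffNorm p = ∑ m ∈ s, |p.coeff m| := by
  refine Finset.sum_subset hs fun m _ hm => ?_
  rw [notMem_support_iff.1 hm, abs_zero]

lemma coeffNorm_nonneg (p : MvPolynomial σ ℝ) : 0 ≤ coeffNorm p :=
  Finset.sum_nonneg fun _ _ => abs_nonneg _

lemma abs_coeff_le_coeffNorm (p : MvPolynomial σ ℝ) (m : σ →₀ ℕ) : |p.coeff m| ≤ coeffNorm p := by
  by_cases h : m ∈ p.support
  · exact Finset.single_le_sum (f := fun m => |p.coeff m|) (fun _ _ => abs_nonneg _) h
  · rw [notMem_support_iff.1 h, abs_zero]; exact coeffNorm_nonneg p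

lemma coeffNorm_add_le (p q : MvPolynomial σ ℝ) : coeffNorm (p + q) ≤ coeffNorm p + coeffNorm q := by
  classical
  rw [coeffNorm_eq_sum (support_add (p := p) (q := q)),
    coeffNorm_eq_sum (Finset.subset_union_left (s₁ := p.support) (s₂ := q.support)),
    coeffNorm_eq_sum (Finset.subset_union_right (s₁ := p.support) (s₂ := q.support)),
    ← Finset.sum_add_distrib]
  exact Finset.sum_le_sum fun m _ => by rw [coeff_add]; exact abs_add_le _ _

@[simp] lemma coeffNorm_zero : coeffNorm (0 : MvPolynomial σ ℝ) = 0 := by simp [coeffNorm]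

lemma coeffNorm_sum_le {ι : Type*} (s : Finset ι) (f : ι → MvPolynomial σ ℝ) :
    coeffNorm (∑ i ∈ s, f i) ≤ ∑ i ∈ s, coeffNorm (f i) := by
  classical
  induction s using Finset.induction_on with
  | empty => simp
  | insert i s hi ih =>
    rw [Finset.sum_insert hi, Finset.sum_insert hi]
    exact (coeffNorm_add_le _ _).trans (add_le_add le_rfl ih)

@[simp] lemma coeffNorm_monomial (m : σ →₀ ℕ) (a : ℝ) : coeffNorm (monomial m a) = |a| := by
  classical
  rw [coeffNorm_eq_sum (support_monomial_subset (s := m) (a := a))]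
  simp

@[simp] lemma coeffNorm_C (a : ℝ) : coeffNorm (C a : MvPolynomial σ ℝ) = |a| :=
  coeffNorm_monomial 0 a

@[simp] lemma coeffNorm_X (i : σ) : coeffNorm (X i : MvPolynomial σ ℝ) = 1 := by
  rw [X, coeffNorm_monomial, abs_one]

lemma coeffNorm_neg (p : MvPolynomial σ ℝ) : coeffNorm (-p) = coeffNorm p := by
  simp [coeffNorm]

lemma coeffNorm_mul_le (p q : MvPolynomial σ ℝ) : coeffNorm (p * q) ≤ coeffNorm p * coeffNorm q := by
  have e : p * q = ∑ m ∈ p.support, ∑ n ∈ q.support, monomial (m + n) (p.coeff m * q.coeff n) := by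
    conv_lhs => rw [p.as_sum, q.as_sum, Finset.sum_mul_sum]
    simp only [monomial_mul]
  have e' : coeffNorm p * coeffNorm q =
      ∑ m ∈ p.support, ∑ n ∈ q.support, |p.coeff m| * |q.coeff n| := Finset.sum_mul_sum _ _ _ _
  rw [e, e']
  refine (coeffNorm_sum_le _ _).trans (Finset.sum_le_sum fun m _ => ?_)
  refine (coeffNorm_sum_le _ _).trans (Finset.sum_le_sum fun n _ => ?_)
  rw [coeffNorm_monomial, abs_mul]

lemma coeffNorm_pow_le (p : MvPolynomial σ ℝ) (n : ℕ) : coeffNorm (p ^ n) ≤ coeffNorm p ^ n := by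
  induction n with
  | zero => rw [pow_zero, pow_zero, ← C_1, coeffNorm_C, abs_one]
  | succ n ih =>
    rw [pow_succ, pow_succ]
    exact (coeffNorm_mul_le _ _).trans (mul_le_mul_of_nonneg_right ih (coeffNorm_nonneg _))

lemma coeffNorm_aeval_X_le {f : ℝ[X]} {h : ℕ} {M : ℝ} (hd : f.natDegree ≤ h)
    (hM : ∀ k, |f.coeff k| ≤ M) (i : σ) :
    coeffNorm (Polynomial.aeval (X i : MvPolynomial σ ℝ) f) ≤ (h + 1) * M := by
  rw [Polynomial.aeval_eq_sum_range' (Nat.lt_succ_of_le hd)]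
  refine (coeffNorm_sum_le _ _).trans ?_
  refine (Finset.sum_le_card_nsmul _ _ M fun k _ => ?_).trans ?_
  · rw [smul_eq_C_mul]
    refine (coeffNorm_mul_le _ _).trans ?_
    rw [coeffNorm_C]
    have h1 := coeffNorm_pow_le (X i : MvPolynomial σ ℝ) k
    rw [coeffNorm_X, one_pow] at h1
    calc |f.coeff k| * coeffNorm (X i ^ k : MvPolynomial σ ℝ) ≤ M * 1 :=
          mul_le_mul (hM k) h1 (coeffNorm_nonneg _) ((abs_nonneg _).trans (hM k))
      _ = M := mul_one M
  · simp

lemma totalDegree_aeval_X_le (f : ℝ[X]) (i : σ) :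
    (Polynomial.aeval (X i : MvPolynomial σ ℝ) f).totalDegree ≤ f.natDegree := by
  rw [Polynomial.aeval_eq_sum_range]
  refine totalDegree_finsetSum_le fun k hk => ?_
  rw [smul_eq_C_mul]
  refine (totalDegree_mul _ _).trans ?_
  rw [totalDegree_C, totalDegree_X_pow, zero_add]
  exact Nat.lt_succ_iff.1 (Finset.mem_range.1 hk)

end MvPolynomial

/-! ### Integrals of squares as finite sums of squares. -/

namespace FlatExp

open scoped MatrixOrder in
lemma exists_gram_of_posSemidef {ι : Type*} [Fintype ι] [DecidableEq ι] {H : Matrix ι ι ℝ}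
    (hH : H.PosSemidef) :
    ∃ B : Matrix ι ι ℝ, ∀ i j, H i j = ∑ k, B k i * B k j := by
  obtain ⟨B, rfl⟩ := CStarAlgebra.nonneg_iff_eq_star_mul_self.mp hH.nonneg
  refine ⟨B, fun i j => ?_⟩
  simp [Matrix.mul_apply, Matrix.star_apply]

/-- A weighted integral over `[0, 1]` of squares of polynomials of degree `h` is a sum of
`h + 1` squares. -/
lemma exists_integral_sq_eq_sum_sq (h : ℕ) {w : ℝ → ℝ} (hw : Continuous w)
    (hw0 : ∀ s ∈ Set.Icc (0 : ℝ) 1, 0 ≤ w s) (hw1 : ∀ s ∈ Set.Icc (0 : ℝ) 1, w s ≤ 1) :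
    ∃ B : Fin (h + 1) → Fin (h + 1) → ℝ, (∀ i j, |B i j| ≤ 1) ∧
      ∀ v : Fin (h + 1) → ℝ, ∫ s in (0 : ℝ)..1, w s * (∑ j : Fin (h + 1), s ^ (j : ℕ) * v j) ^ 2 =
        ∑ i, (∑ j, B i j * v j) ^ 2 := by
  let H : Matrix (Fin (h + 1)) (Fin (h + 1)) ℝ :=
    Matrix.of fun i j => ∫ s in (0 : ℝ)..1, w s * (s ^ (i : ℕ) * s ^ (j : ℕ))
  have hint : ∀ v : Fin (h + 1) → ℝ, ∫ s in (0 : ℝ)..1, w s * (∑ j : Fin (h + 1), s ^ (j : ℕ) * v j) ^ 2 =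
      ∑ i, ∑ j, H i j * (v i * v j) := by
    intro v
    have e : ∀ s : ℝ, w s * (∑ j : Fin (h + 1), s ^ (j : ℕ) * v j) ^ 2 =
        ∑ i : Fin (h + 1), ∑ j : Fin (h + 1),
          w s * (s ^ (i : ℕ) * s ^ (j : ℕ)) * (v i * v j) := by
      intro s
      rw [pow_two, Finset.sum_mul_sum, Finset.mul_sum]
      refine Finset.sum_congr rfl fun i _ => ?_
      rw [Finset.mul_sum]
      exact Finset.sum_congr rfl fun j _ => by ring
    simp_rw [e]
    rw [intervalIntegral.integral_finsetSum]
    · refine Finset.sum_congr rfl fun i _ => ?_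
      rw [intervalIntegral.integral_finsetSum]
      · refine Finset.sum_congr rfl fun j _ => ?_
        rw [intervalIntegral.integral_mul_const]; rfl
      · exact fun j _ => Continuous.intervalIntegrable (by fun_prop) _ _
    · exact fun i _ => Continuous.intervalIntegrable (by fun_prop) _ _
  have hpos : ∀ v : Fin (h + 1) → ℝ, 0 ≤ ∑ i, ∑ j, H i j * (v i * v j) := fun v => by
    rw [← hint]
    exact intervalIntegral.integral_nonneg zero_le_one fun s hs =>
      mul_nonneg (hw0 s hs) (sq_nonneg _)
  have hH : H.PosSemidef := by
    refine Matrix.PosSemidef.of_dotProduct_mulVec_nonneg ?_ fun v => ?_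
    · ext i j
      simp only [Matrix.conjTranspose_apply, H, Matrix.of_apply, star_trivial]
      simp_rw [mul_comm (_ ^ (j : ℕ)) (_ ^ (i : ℕ))]
    · convert! hpos v using 1
      simp only [dotProduct, Matrix.mulVec, star_trivial, Finset.mul_sum]
      exact Finset.sum_congr rfl fun i _ => Finset.sum_congr rfl fun j _ => by ring
  obtain ⟨B, hB⟩ := exists_gram_of_posSemidef hH
  refine ⟨B, fun i j => ?_, fun v => ?_⟩
  -- A diagonal entry of the Gram matrix is the squared length of a column of B, and it is at most 1
  -- because the weight and the powers of s are at most 1 on [0,1].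
  · have h1 : B i j ^ 2 ≤ H j j := by
      rw [hB j j]
      have := Finset.single_le_sum (f := fun k => B k j * B k j)
        (fun k _ => mul_self_nonneg _) (Finset.mem_univ i)
      rw [pow_two]; exact this
    have h2 : H j j ≤ 1 := by
      have h3 : H j j ≤ ∫ s in (0 : ℝ)..1, (1 : ℝ) := by
        refine intervalIntegral.integral_mono_on zero_le_one
          (Continuous.intervalIntegrable (by fun_prop) _ _) (by simp) fun s hs => ?_
        have h4 : s ^ (j : ℕ) ≤ 1 := pow_le_one₀ hs.1 hs.2
        have h5 : 0 ≤ s ^ (j : ℕ) := pow_nonneg hs.1 _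
        have h6 : s ^ (j : ℕ) * s ^ (j : ℕ) ≤ 1 := mul_le_one₀ h4 h5 h4
        exact mul_le_one₀ (hw1 s hs) (by positivity) h6
      simpa using h3
    rw [← sq_le_one_iff_abs_le_one]; linarith
  · rw [hint]
    have e : ∀ k, (∑ j, B k j * v j) ^ 2 = ∑ i, ∑ j, B k i * B k j * (v i * v j) := fun k => by
      rw [pow_two, Finset.sum_mul_sum]
      exact Finset.sum_congr rfl fun i _ => Finset.sum_congr rfl fun j _ => by ring
    simp_rw [e, hB, Finset.sum_mul]
    rw [Finset.sum_comm' (t' := Finset.univ) (s' := fun _ => Finset.univ) (by simp)]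
    refine Eq.trans ?_ Finset.sum_comm
    rw [Finset.sum_comm]
    exact Finset.sum_congr rfl fun i _ => Finset.sum_comm

open MvPolynomial in
/-- The coefficient of `s ^ j` in `f (x + s (y - x))`. -/
noncomputable def segmentCoeff (f : ℝ[X]) (j : ℕ) : MvPolynomial (Fin 2) ℝ :=
  (X 1 - X 0) ^ j * Polynomial.aeval (X 0 : MvPolynomial (Fin 2) ℝ) (hasseDeriv j f)

open MvPolynomial in
lemma eval_aeval_X {σ : Type*} (v : σ → ℝ) (i : σ) (f : ℝ[X]) :
    MvPolynomial.eval v (Polynomial.aeval (X i : MvPolynomial σ ℝ) f) = f.eval (v i) := by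
  have := Polynomial.hom_eval₂ f (algebraMap ℝ (MvPolynomial σ ℝ)) (MvPolynomial.eval v) (X i)
  rw [Polynomial.aeval_def, this, MvPolynomial.eval_X]
  have e : (MvPolynomial.eval v).comp (algebraMap ℝ (MvPolynomial σ ℝ)) = RingHom.id ℝ := by
    ext a; simp
  rw [e, Polynomial.eval₂_id]

/-- Taylor expansion at x: along the segment f is a polynomial in s whose coefficients are
polynomials in x and y, the form required by the Gram factorization. -/
lemma eval_segment_eq_sum {f : ℝ[X]} {h : ℕ} (hf : f.natDegree ≤ h) (v : Fin 2 → ℝ) (s : ℝ) :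
    f.eval (v 0 + s * (v 1 - v 0)) =
      ∑ j : Fin (h + 1), s ^ (j : ℕ) * MvPolynomial.eval v (segmentCoeff f j) := by
  have e : f.eval (v 0 + s * (v 1 - v 0)) = (taylor (v 0) f).eval (s * (v 1 - v 0)) := by
    rw [taylor_eval, add_comm]
  have hd : (taylor (v 0) f).natDegree < h + 1 := by rw [natDegree_taylor]; omega
  rw [e, Polynomial.eval_eq_sum_range' hd, Fin.sum_univ_eq_sum_range (fun j =>
    s ^ j * MvPolynomial.eval v (segmentCoeff f j))]
  refine Finset.sum_congr rfl fun j _ => ?_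
  rw [taylor_coeff, segmentCoeff, map_mul, eval_aeval_X, map_pow, map_sub, MvPolynomial.eval_X,
    MvPolynomial.eval_X, mul_pow]
  ring

lemma totalDegree_segmentCoeff_le {f : ℝ[X]} {h j : ℕ} (hf : f.natDegree ≤ h) (hj : j ≤ h) :
    (segmentCoeff f j).totalDegree ≤ h := by
  refine (MvPolynomial.totalDegree_mul _ _).trans ?_
  have h1 : (((MvPolynomial.X 1 - MvPolynomial.X 0) ^ j : MvPolynomial (Fin 2) ℝ)).totalDegree
      ≤ j := by
    refine (MvPolynomial.totalDegree_pow _ _).trans ?_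
    have : (MvPolynomial.X 1 - MvPolynomial.X 0 : MvPolynomial (Fin 2) ℝ).totalDegree ≤ 1 :=
      (MvPolynomial.totalDegree_sub _ _).trans (by simp)
    nlinarith
  have h2 := MvPolynomial.totalDegree_aeval_X_le (σ := Fin 2) (hasseDeriv j f) 0
  have h3 := natDegree_hasseDeriv_le f j
  omega

lemma abs_coeff_hasseDeriv_le {f : ℝ[X]} {h : ℕ} {M : ℝ} (hf : f.natDegree ≤ h)
    (hM : ∀ k, |f.coeff k| ≤ M) (j k : ℕ) : |(hasseDeriv j f).coeff k| ≤ 2 ^ h * M := by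
  have hM0 : 0 ≤ M := (abs_nonneg _).trans (hM 0)
  rw [hasseDeriv_coeff, abs_mul, Nat.abs_cast]
  rcases le_or_gt (k + j) h with hk | hk
  · have : (((k + j).choose j : ℕ) : ℝ) ≤ 2 ^ h := by
      have h1 : (k + j).choose j ≤ 2 ^ h :=
        (Nat.choose_le_two_pow _ _).trans (Nat.pow_le_pow_right (by norm_num) hk)
      exact_mod_cast h1
    exact mul_le_mul this (hM _) (abs_nonneg _) (by positivity)
  · rw [coeff_eq_zero_of_natDegree_lt (hf.trans_lt hk), abs_zero, mul_zero]
    positivity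

lemma coeffNorm_segmentCoeff_le {f : ℝ[X]} {h j : ℕ} {M : ℝ} (hf : f.natDegree ≤ h) (hj : j ≤ h)
    (hM : ∀ k, |f.coeff k| ≤ M) :
    MvPolynomial.coeffNorm (segmentCoeff f j) ≤ 4 ^ h * ((h + 1) * M) := by
  have hM0 : 0 ≤ M := (abs_nonneg _).trans (hM 0)
  have h1 : MvPolynomial.coeffNorm
      ((MvPolynomial.X 1 - MvPolynomial.X 0) ^ j : MvPolynomial (Fin 2) ℝ) ≤ 2 ^ h := by
    refine (MvPolynomial.coeffNorm_pow_le _ _).trans ?_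
    have : MvPolynomial.coeffNorm
        (MvPolynomial.X 1 - MvPolynomial.X 0 : MvPolynomial (Fin 2) ℝ) ≤ 2 := by
      rw [sub_eq_add_neg]
      refine (MvPolynomial.coeffNorm_add_le _ _).trans ?_
      rw [MvPolynomial.coeffNorm_neg, MvPolynomial.coeffNorm_X, MvPolynomial.coeffNorm_X]
      norm_num
    calc _ ≤ (2 : ℝ) ^ j := pow_le_pow_left₀ (MvPolynomial.coeffNorm_nonneg _) this j
      _ ≤ 2 ^ h := pow_le_pow_right₀ (by norm_num) hj
  have h2 := MvPolynomial.coeffNorm_aeval_X_le (σ := Fin 2) (f := hasseDeriv j f)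
    ((natDegree_hasseDeriv_le f j).trans (by omega : _ ≤ h)) (abs_coeff_hasseDeriv_le hf hM j) 0
  refine (MvPolynomial.coeffNorm_mul_le _ _).trans ?_
  calc _ ≤ (2 : ℝ) ^ h * ((h + 1) * (2 ^ h * M)) :=
        mul_le_mul h1 h2 (MvPolynomial.coeffNorm_nonneg _) (by positivity)
    _ = _ := by
        rw [show (4 : ℝ) = 2 * 2 by norm_num, mul_pow]; ring

/-- `ℓ² ∫ w(s) f(x + s (y - x))² ds` is a sum of `h + 1` squares with controlled coefficients. -/
lemma exists_sos_integral {f : ℝ[X]} {h : ℕ} {M : ℝ} (hf : f.natDegree ≤ h)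
    (hM : ∀ k, |f.coeff k| ≤ M) {w : ℝ → ℝ} (hw : Continuous w)
    (hw0 : ∀ s ∈ Set.Icc (0 : ℝ) 1, 0 ≤ w s) (hw1 : ∀ s ∈ Set.Icc (0 : ℝ) 1, w s ≤ 1)
    {l : MvPolynomial (Fin 2) ℝ} (hl : l.totalDegree ≤ 2) (hl' : MvPolynomial.coeffNorm l ≤ 6) :
    ∃ g : Fin (h + 1) → MvPolynomial (Fin 2) ℝ, (∀ i, (g i).totalDegree ≤ h + 2) ∧
      (∀ i, MvPolynomial.coeffNorm (g i) ≤ 6 * ((h + 1) * (4 ^ h * ((h + 1) * M)))) ∧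
      ∀ v : Fin 2 → ℝ, ∑ i, MvPolynomial.eval v (g i) ^ 2 = MvPolynomial.eval v l ^ 2 *
        ∫ s in (0 : ℝ)..1, w s * f.eval (v 0 + s * (v 1 - v 0)) ^ 2 := by
  obtain ⟨B, hB, hBv⟩ := exists_integral_sq_eq_sum_sq h hw hw0 hw1
  have hM0 : 0 ≤ M := (abs_nonneg _).trans (hM 0)
  refine ⟨fun i => l * ∑ j : Fin (h + 1), MvPolynomial.C (B i j) * segmentCoeff f j,
    fun i => ?_, fun i => ?_, fun v => ?_⟩
  · refine (MvPolynomial.totalDegree_mul _ _).trans ?_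
    have : (∑ j : Fin (h + 1), MvPolynomial.C (B i j) * segmentCoeff f j).totalDegree ≤ h := by
      refine MvPolynomial.totalDegree_finsetSum_le fun j _ => ?_
      refine (MvPolynomial.totalDegree_mul _ _).trans ?_
      rw [MvPolynomial.totalDegree_C, zero_add]
      exact totalDegree_segmentCoeff_le hf (by omega)
    omega
  · refine (MvPolynomial.coeffNorm_mul_le _ _).trans ?_
    refine mul_le_mul hl' ?_ (MvPolynomial.coeffNorm_nonneg _) (by norm_num)
    refine (MvPolynomial.coeffNorm_sum_le _ _).trans ?_
    refine (Finset.sum_le_card_nsmul _ _ (4 ^ h * ((h + 1) * M)) fun j _ => ?_).trans ?_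
    · refine (MvPolynomial.coeffNorm_mul_le _ _).trans ?_
      rw [MvPolynomial.coeffNorm_C]
      calc _ ≤ 1 * (4 ^ h * ((h + 1) * M)) := mul_le_mul (hB i j)
            (coeffNorm_segmentCoeff_le hf (by omega) hM) (MvPolynomial.coeffNorm_nonneg _)
            zero_le_one
        _ = _ := one_mul _
    · simp
  · simp_rw [eval_segment_eq_sum hf v, hBv]
    rw [Finset.mul_sum]
    refine Finset.sum_congr rfl fun i _ => ?_
    rw [map_mul, mul_pow, map_sum]
    simp only [map_mul, MvPolynomial.eval_C]

/-- Missing squares are padded with zeros, so only an upper bound on their number is needed. -/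
lemma isBoundedSOS_of_fintype {σ ι : Type*} [Fintype ι] {k d : ℕ} {B : ℝ}
    {p : MvPolynomial σ ℝ} (hk : Fintype.card ι ≤ k) (q : ι → MvPolynomial σ ℝ)
    (hq : ∀ i, IsBoundedPolynomial d B (q i)) (hp : p = ∑ i, q i ^ 2) : IsBoundedSOS k d B p := by
  classical
  obtain ⟨e⟩ : Nonempty (ι ↪ Fin k) :=
    Function.Embedding.nonempty_of_card_le (by simpa using hk)
  refine ⟨Function.extend e q 0, fun i => ?_, ?_⟩
  · by_cases hi : ∃ j, e j = i
    · obtain ⟨j, rfl⟩ := hi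
      rw [e.injective.extend_apply]
      exact hq j
    · rw [Function.extend_apply' _ _ _ hi]
      exact ⟨by simp, by simp⟩
  · rw [hp, ← Finset.sum_subset (Finset.subset_univ (Finset.univ.map e)), Finset.sum_map]
    · simp only [e.injective.extend_apply]
    · intro i _ hi
      rw [Function.extend_apply' _ _ _ (by simpa using hi)]
      simp

/-- Factorials increase, so a uniform coefficient bound paid for at d! handles every lower degree.
-/
lemma isBoundedPolynomial_of_coeffNorm_le {σ : Type*} {d : ℕ} {B M : ℝ} {p : MvPolynomial σ ℝ}
    (hd : p.totalDegree ≤ d) (hp : MvPolynomial.coeffNorm p ≤ M) (hB : M * d.factorial ≤ B) :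
    IsBoundedPolynomial d B p := by
  refine ⟨hd, fun m hm => ?_⟩
  have h1 : m.degree ≤ d := (MvPolynomial.le_totalDegree hm).trans hd
  have hM : 0 ≤ M := (MvPolynomial.coeffNorm_nonneg p).trans hp
  rw [le_div_iff₀ (by positivity)]
  have h2 : (m.degree.factorial : ℝ) ≤ d.factorial := by exact_mod_cast Nat.factorial_le h1
  calc _ ≤ M * d.factorial :=
        mul_le_mul ((MvPolynomial.abs_coeff_le_coeffNorm p m).trans hp) h2 (by positivity) hM
    _ ≤ B := hB

lemma exists_sum_two_sq_of_bound {A : ℝ} {p : ℝ[X]} (hpos : ∀ x, 0 < p.eval x)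
    (hp : HasLeadingCoeffAndRootsBound A p) :
    ∃ (h : ℕ) (f : Fin 2 → ℝ[X]), p.natDegree = 2 * h ∧ (∀ i, (f i).natDegree ≤ h) ∧
      (∀ i k, |(f i).coeff k| ≤ (1 + 2 * A) ^ h) ∧
      ∀ u, p.eval u = ∑ i, (f i).eval u ^ 2 := by
  obtain ⟨h, a, b, h1, h2, h3, h4, h5, h6⟩ := exists_sum_two_sq_of_pos p hpos hp.roots_le
  have hs := Real.sq_sqrt hp.leadingCoeff_pos.le
  have hs1 : √p.leadingCoeff ≤ 1 := Real.sqrt_le_one.2 hp.leadingCoeff_le_one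
  have hs0 := Real.sqrt_nonneg p.leadingCoeff
  have hc : ∀ q : ℝ[X], (∀ k, |q.coeff k| ≤ (1 + 2 * A) ^ h) →
      ∀ k, |(C √p.leadingCoeff * q).coeff k| ≤ (1 + 2 * A) ^ h := fun q hq k => by
    rw [coeff_C_mul, abs_mul, abs_of_nonneg hs0]
    calc _ ≤ 1 * (1 + 2 * A) ^ h := mul_le_mul hs1 (hq k) (abs_nonneg _) zero_le_one
      _ = _ := one_mul _
  refine ⟨h, ![C √p.leadingCoeff * a, C √p.leadingCoeff * b], h1, ?_, ?_, fun u => ?_⟩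
  · simp only [Fin.forall_fin_two]
    exact ⟨(natDegree_C_mul_le _ _).trans h2, (natDegree_C_mul_le _ _).trans h3⟩
  · simp only [Fin.forall_fin_two]
    exact ⟨hc a h4, hc b h5⟩
  · have h7 : p.eval u = p.leadingCoeff * (a.eval u ^ 2 + b.eval u ^ 2) := by
      conv_lhs => rw [h6]
      simp only [eval_mul, eval_C, eval_add, eval_pow]
    simp only [Fin.sum_univ_two, Matrix.cons_val_zero, Matrix.cons_val_one, eval_mul, eval_C]
    rw [mul_pow, mul_pow, hs, h7]; ring

/-- The third difference at 0, 1, 2, 3 annihilates quadratics. For e^{-x} it has size (1 - 1/e)³ >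
0.25, whereas errors of 0.03 contribute at most 8·0.03 = 0.24. The conclusion ensures h + 2 ≤ 2h for
degree 2h. -/
lemma two_lt_natDegree {P : ℝ[X]} {ε κ : ℝ} (hκ : 3 ≤ κ) (hε : ε ≤ 0.03)
    (hP : ∀ x ∈ Set.Icc (-κ) κ, |P.eval x - Real.exp (-x)| ≤ ε) : 2 < P.natDegree := by
  by_contra! hd
  have e : ∀ x, P.eval x = P.coeff 0 + P.coeff 1 * x + P.coeff 2 * x ^ 2 := fun x => by
    rw [Polynomial.eval_eq_sum_range' (Nat.lt_succ_of_le hd)]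
    simp [Finset.sum_range_succ]
  have h0 := abs_le.1 (hP 0 ⟨by linarith, by linarith⟩)
  have h1 := abs_le.1 (hP 1 ⟨by linarith, by linarith⟩)
  have h2 := abs_le.1 (hP 2 ⟨by linarith, by linarith⟩)
  have h3 := abs_le.1 (hP 3 ⟨by linarith, by linarith⟩)
  have e2 : Real.exp (-2) = Real.exp (-1) ^ 2 := by rw [← Real.exp_nat_mul]; norm_num
  have e3 : Real.exp (-3) = Real.exp (-1) ^ 3 := by rw [← Real.exp_nat_mul]; norm_num
  rw [e] at h0 h1 h2 h3
  rw [e2] at h2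
  rw [e3] at h3
  rw [neg_zero, Real.exp_zero] at h0
  have ht := Real.exp_neg_one_lt_d9
  set t := Real.exp (-1)
  have h63 : (0.63 : ℝ) ^ 3 ≤ (1 - t) ^ 3 := pow_le_pow_left₀ (by norm_num) (by linarith) 3
  nlinarith

/-! ### The integral representation of R. -/

lemma hasDerivAt_eval_segment (f : ℝ[X]) (x y s : ℝ) :
    HasDerivAt (fun s => f.eval (x + s * (y - x)))
      ((derivative f).eval (x + s * (y - x)) * (y - x)) s := by
  have h1 : HasDerivAt (fun s : ℝ => x + s * (y - x)) (y - x) s := by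
    simpa using ((hasDerivAt_id s).mul_const (y - x)).const_add x
  exact (f.hasDerivAt _).comp s h1

lemma sub_eq_mul_integral {P U : ℝ[X]} (hU : derivative U = P) (x y : ℝ) :
    U.eval x - U.eval y = (x - y) * ∫ s in (0 : ℝ)..1, P.eval (x + s * (y - x)) := by
  have h := intervalIntegral.integral_eq_sub_of_hasDerivAt (a := 0) (b := 1)
    (fun s _ => hasDerivAt_eval_segment U x y s)
    (Continuous.intervalIntegrable (by fun_prop) _ _)
  rw [hU, intervalIntegral.integral_mul_const] at h
  simp only [one_mul, zero_mul, add_zero, add_sub_cancel] at h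
  linarith

/-- The integrand is the s-derivative of -(1-s)P(x + s(y-x)). This puts P(x) under the same integral
as the difference of U, at the price of a term in P'. -/
lemma eval_eq_integral (P : ℝ[X]) (x y : ℝ) :
    P.eval x = ∫ s in (0 : ℝ)..1, (P.eval (x + s * (y - x)) +
      (1 - s) * ((x - y) * (derivative P).eval (x + s * (y - x)))) := by
  have h1 : ∀ s : ℝ, HasDerivAt (fun s => -((1 - s) * P.eval (x + s * (y - x))))
      (P.eval (x + s * (y - x)) +
        (1 - s) * ((x - y) * (derivative P).eval (x + s * (y - x)))) s := fun s => by
    have := (((hasDerivAt_id s).const_sub 1).mul (hasDerivAt_eval_segment P x y s)).neg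
    convert! this using 1
    simp only [id]
    ring
  have h := intervalIntegral.integral_eq_sub_of_hasDerivAt (a := 0) (b := 1)
    (fun s _ => h1 s) (Continuous.intervalIntegrable (by fun_prop) _ _)
  rw [h]; simp

/-- The weights in the decomposition of the quadratic factor into squares. -/
noncomputable def quadWeight (i : Fin 3) (s : ℝ) : ℝ :=
  ![0.000125 * (1 - s), 0.49975 / 198 - 0.000125 * (1 - s) / 4,
    0.125 / 198 - 0.000125 * (1 - s)] i

/-- The linear forms whose squares occur in the quadratic factor, multiplied by `x - y`. -/
noncomputable def quadForm (c : ℝ) (i : Fin 3) : MvPolynomial (Fin 2) ℝ :=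
  (MvPolynomial.X 0 - MvPolynomial.X 1) *
    ![MvPolynomial.X 0 - MvPolynomial.X 1 - MvPolynomial.C c, 1,
      MvPolynomial.X 0 - MvPolynomial.X 1] i

lemma continuous_quadWeight (i : Fin 3) : Continuous (quadWeight i) := by
  unfold quadWeight
  fin_cases i <;> simp <;> fun_prop

/-- The smallness of 0.00025 enters here: 0.125/198 exceeds 0.000125, so subtracting the cost of the
completed square leaves nonnegative weights. -/
lemma quadWeight_mem (i : Fin 3) {s : ℝ} (hs : s ∈ Set.Icc (0 : ℝ) 1) :
    0 ≤ quadWeight i s ∧ quadWeight i s ≤ 1 := by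
  obtain ⟨h0, h1⟩ := hs
  unfold quadWeight
  fin_cases i <;> norm_num <;> constructor <;> linarith

lemma totalDegree_X_sub_X_le :
    (MvPolynomial.X 0 - MvPolynomial.X 1 : MvPolynomial (Fin 2) ℝ).totalDegree ≤ 1 :=
  (MvPolynomial.totalDegree_sub _ _).trans (by simp)

lemma coeffNorm_X_sub_X_le :
    MvPolynomial.coeffNorm (MvPolynomial.X 0 - MvPolynomial.X 1 : MvPolynomial (Fin 2) ℝ) ≤ 2 := by
  rw [sub_eq_add_neg]
  refine (MvPolynomial.coeffNorm_add_le _ _).trans ?_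
  rw [MvPolynomial.coeffNorm_neg, MvPolynomial.coeffNorm_X, MvPolynomial.coeffNorm_X]
  norm_num

lemma totalDegree_quadForm_le (c : ℝ) (i : Fin 3) : (quadForm c i).totalDegree ≤ 2 := by
  have h := totalDegree_X_sub_X_le
  refine (MvPolynomial.totalDegree_mul _ _).trans ?_
  have : ((![MvPolynomial.X 0 - MvPolynomial.X 1 - MvPolynomial.C c, 1,
      MvPolynomial.X 0 - MvPolynomial.X 1] : Fin 3 → MvPolynomial (Fin 2) ℝ) i).totalDegree
      ≤ 1 := by
    fin_cases i
    · exact (MvPolynomial.totalDegree_sub _ _).trans (by simpa using h)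
    · simp
    · exact h
  omega

lemma coeffNorm_quadForm_le {c : ℝ} (hc : |c| ≤ 1) (i : Fin 3) :
    MvPolynomial.coeffNorm (quadForm c i) ≤ 6 := by
  have h := coeffNorm_X_sub_X_le
  refine (MvPolynomial.coeffNorm_mul_le _ _).trans ?_
  have : MvPolynomial.coeffNorm ((![MvPolynomial.X 0 - MvPolynomial.X 1 - MvPolynomial.C c, 1,
      MvPolynomial.X 0 - MvPolynomial.X 1] : Fin 3 → MvPolynomial (Fin 2) ℝ) i) ≤ 3 := by
    fin_cases i
    · change MvPolynomial.coeffNorm (MvPolynomial.X 0 - MvPolynomial.X 1 - MvPolynomial.C c) ≤ 3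
      rw [sub_eq_add_neg _ (MvPolynomial.C c)]
      refine (MvPolynomial.coeffNorm_add_le _ _).trans ?_
      rw [MvPolynomial.coeffNorm_neg, MvPolynomial.coeffNorm_C]
      linarith
    · change MvPolynomial.coeffNorm 1 ≤ 3
      rw [← MvPolynomial.C_1, MvPolynomial.coeffNorm_C]; norm_num
    · exact h.trans (by norm_num)
  have h0 := MvPolynomial.coeffNorm_nonneg
    (MvPolynomial.X 0 - MvPolynomial.X 1 : MvPolynomial (Fin 2) ℝ)
  nlinarith

/-- Completing the square: the cross term is carried by 0.000125(1-s)(u-c)², u = x-y, and the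
surplus u² and c² = 1/4 are deducted from the weights of the other two squares. -/
lemma sum_quad (c : ℝ) (hc : c ^ 2 = 1 / 4) (v : Fin 2 → ℝ) (s : ℝ) :
    ∑ i, MvPolynomial.eval v (quadForm c i) ^ 2 * quadWeight i s =
      (v 0 - v 1) ^ 2 * (0.49975 / 198 + 0.125 / 198 * (v 0 - v 1) ^ 2 -
        0.00025 * (1 - s) * c * (v 0 - v 1)) := by
  simp [Fin.sum_univ_three, quadForm, quadWeight]
  linear_combination 0.000125 * (1 - s) * (v 0 - v 1) ^ 2 * hc

/-- P and P' are expressed through 99P ± P'; the coefficient ±1/2 of these in P' gives c = ±1/2, and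
0.49975 = 0.5 - 0.00025. -/
lemma eval_sosTarget {P U : ℝ[X]} (hU : derivative U = P) (v : Fin 2 → ℝ) :
    MvPolynomial.eval v (sosTarget P U) =
      ∫ s in (0 : ℝ)..1,
        ((∑ i, MvPolynomial.eval v (quadForm (1 / 2) i) ^ 2 * quadWeight i s) *
            (C 99 * P + derivative P).eval (v 0 + s * (v 1 - v 0)) +
          (∑ i, MvPolynomial.eval v (quadForm (-1 / 2) i) ^ 2 * quadWeight i s) *
            (C 99 * P - derivative P).eval (v 0 + s * (v 1 - v 0))) := by
  have e1 : MvPolynomial.eval v (sosTarget P U) =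
      0.5 * (v 0 - v 1) * (1 + 0.25 * (v 0 - v 1) ^ 2) * (U.eval (v 0) - U.eval (v 1)) -
        0.00025 * (v 0 - v 1) ^ 2 * P.eval (v 0) := by
    simp only [sosTarget, map_sub, map_mul, map_add, map_pow, map_one, MvPolynomial.eval_C,
      MvPolynomial.eval_X, eval_aeval_X]
  rw [e1, sub_eq_mul_integral hU, eval_eq_integral P (v 0) (v 1)]
  simp_rw [sum_quad (1 / 2) (by norm_num), sum_quad (-1 / 2) (by norm_num)]
  rw [show ∀ a b c d e f : ℝ, 0.5 * a * b * (a * c) - d * e * f =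
    (0.5 * a ^ 2 * b) * c - (d * e) * f by intros; ring,
    ← intervalIntegral.integral_const_mul, ← intervalIntegral.integral_const_mul,
    ← intervalIntegral.integral_sub]
  · refine intervalIntegral.integral_congr fun s _ => ?_
    simp only [eval_add, eval_sub, eval_mul, eval_C]
    ring
  · exact Continuous.intervalIntegrable (by fun_prop) _ _
  · exact Continuous.intervalIntegrable (by fun_prop) _ _

/-! ### Counting squares and bounding their coefficients. -/

lemma natDegree_C_mul_add_derivative {P : ℝ[X]} (hd : P.natDegree ≠ 0) :
    (C 99 * P + derivative P).natDegree = P.natDegree ∧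
      (C 99 * P - derivative P).natDegree = P.natDegree := by
  have h1 : (C (99 : ℝ) * P).natDegree = P.natDegree := natDegree_C_mul (by norm_num)
  have h2 := natDegree_derivative_lt hd
  constructor
  · rw [natDegree_add_eq_left_of_natDegree_lt (by rw [h1]; exact h2), h1]
  · rw [natDegree_sub_eq_left_of_natDegree_lt (by rw [h1]; exact h2), h1]

/-- The leading exponent is h times that of the root bound: h ≤ 10⁹β²L/2 against 10¹⁴β³L² uses half
of 10²³β⁵L³. The factorial costs at most (2h)², of order β⁴L², and fits in the other half. -/
lemma sos_exponent_le {β L : ℝ} (hβ : 1 ≤ β) (hL : 1 ≤ L) {h : ℕ}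
    (hd : ((2 * h : ℕ) : ℝ) ≤ 10 ^ 9 * β ^ 2 * L) :
    6 * ((h + 1) * (4 ^ h * ((h + 1) * (1 + 2 * Real.exp (10 ^ 14 * β ^ 3 * L ^ 2)) ^ h))) *
      (2 * h).factorial ≤ Real.exp (10 ^ 23 * β ^ 5 * L ^ 3) := by
  set a := 10 ^ 14 * β ^ 3 * L ^ 2 with ha
  have ha0 : 0 ≤ a := by positivity
  have hh : (h : ℝ) ≤ 10 ^ 9 / 2 * (β ^ 2 * L) := by push_cast at hd; linarith
  have e1 : (h + 1 : ℝ) ≤ Real.exp h := Real.add_one_le_exp _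
  have e4 : (4 : ℝ) ^ h ≤ Real.exp (h * 4) := by
    rw [Real.exp_nat_mul]
    gcongr
    linarith [Real.add_one_le_exp (4 : ℝ)]
  have e6 : (6 : ℝ) ≤ Real.exp 6 := by linarith [Real.add_one_le_exp (6 : ℝ)]
  have eA : (1 + 2 * Real.exp a) ^ h ≤ Real.exp (h * (2 + a)) := by
    rw [Real.exp_nat_mul, Real.exp_add]
    have h3 : (3 : ℝ) ≤ Real.exp 2 := by linarith [Real.add_one_le_exp (2 : ℝ)]
    have h1 : 1 ≤ Real.exp a := Real.one_le_exp ha0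
    gcongr
    nlinarith
  have efac : ((2 * h).factorial : ℝ) ≤ Real.exp ((2 * h : ℕ) * (2 * h : ℕ)) := by
    rw [Real.exp_nat_mul]
    calc ((2 * h).factorial : ℝ) ≤ ((2 * h : ℕ) : ℝ) ^ (2 * h) := by
          exact_mod_cast Nat.factorial_le_pow _
      _ ≤ _ := by
          gcongr
          linarith [Real.add_one_le_exp ((2 * h : ℕ) : ℝ)]
  calc _ ≤ Real.exp 6 * (Real.exp h * (Real.exp (h * 4) * (Real.exp h * Real.exp (h * (2 + a))))) *
        Real.exp ((2 * h : ℕ) * (2 * h : ℕ)) := by gcongr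
    _ = Real.exp (6 + (h + (h * 4 + (h + h * (2 + a)))) + (2 * h : ℕ) * (2 * h : ℕ)) := by
        simp only [Real.exp_add]
    _ ≤ _ := by
        refine Real.exp_le_exp.2 ?_
        have g1 : β ^ 2 * L ≤ β ^ 5 * L ^ 3 :=
          mul_le_mul (pow_le_pow_right₀ hβ (by norm_num)) (le_self_pow₀ hL (by norm_num))
            (by positivity) (by positivity)
        have g2 : β ^ 4 * L ^ 2 ≤ β ^ 5 * L ^ 3 :=
          mul_le_mul (pow_le_pow_right₀ hβ (by norm_num)) (pow_le_pow_right₀ hL (by norm_num))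
            (by positivity) (by positivity)
        have g0 : 1 ≤ β ^ 5 * L ^ 3 :=
          one_le_mul_of_one_le_of_one_le (one_le_pow₀ hβ) (one_le_pow₀ hL)
        have g3 : h * a ≤ 10 ^ 23 / 2 * (β ^ 5 * L ^ 3) := by
          calc h * a ≤ 10 ^ 9 / 2 * (β ^ 2 * L) * a := mul_le_mul_of_nonneg_right hh ha0
            _ = _ := by rw [ha]; ring
        have g4 : ((2 * h : ℕ) : ℝ) * (2 * h : ℕ) ≤ 10 ^ 18 * (β ^ 4 * L ^ 2) := by
          calc _ ≤ (10 ^ 9 * β ^ 2 * L) * (10 ^ 9 * β ^ 2 * L) := by gcongr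
            _ = _ := by ring
        nlinarith

theorem isBoundedSOS_sosTarget {β ε : ℝ} (hβ : 1 ≤ β) (hε : ε ≤ 0.03)
    (hL : 3 ≤ Real.log (1 / ε)) {P U : ℝ[X]} (hP : IsGoodFlatPolynomial β ε P)
    (hU : derivative U = P) :
    IsBoundedSOS (6 * P.natDegree ^ 2) P.natDegree
      (Real.exp (10 ^ 23 * β ^ 5 * Real.log (1 / ε) ^ 3)) (sosTarget P U) := by
  set L := Real.log (1 / ε)
  have hdeg := two_lt_natDegree (by nlinarith : 3 ≤ β * L) hε hP.flat.approx
  have hder := fun x => abs_lt.1 (hP.deriv_lt x)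
  obtain ⟨hd1, hd2⟩ := natDegree_C_mul_add_derivative (P := P) (by omega)
  obtain ⟨h, f, h1, h2, h3, h4⟩ := exists_sum_two_sq_of_bound
    (fun x => by rw [eval_add, eval_mul, eval_C]; linarith [hder x]) hP.bound_add
  obtain ⟨h', f', h1', h2', h3', h4'⟩ := exists_sum_two_sq_of_bound
    (fun x => by rw [eval_sub, eval_mul, eval_C]; linarith [hder x]) hP.bound_sub
  obtain rfl : h' = h := by omega
  rw [hd1] at h1
  choose g g1 g2 g3 using fun (i : Fin 3) (j : Fin 2) =>
    exists_sos_integral (h2 j) (h3 j) (continuous_quadWeight i)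
      (fun s hs => (quadWeight_mem i hs).1) (fun s hs => (quadWeight_mem i hs).2)
      (totalDegree_quadForm_le (1 / 2) i)
      (coeffNorm_quadForm_le (c := 1 / 2) (by rw [abs_of_pos] <;> norm_num) i)
  choose g' g1' g2' g3' using fun (i : Fin 3) (j : Fin 2) =>
    exists_sos_integral (h2' j) (h3' j) (continuous_quadWeight i)
      (fun s hs => (quadWeight_mem i hs).1) (fun s hs => (quadWeight_mem i hs).2)
      (totalDegree_quadForm_le (-1 / 2) i)
      (coeffNorm_quadForm_le (c := -1 / 2) (by rw [abs_of_neg] <;> norm_num) i)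
  have hexp := sos_exponent_le hβ (by linarith : 1 ≤ L) (h := h') (by
    rw [← h1]; exact hP.natDegree_le)
  refine isBoundedSOS_of_fintype
    (ι := (Fin 3 × Fin 2 × Fin (h' + 1)) ⊕ (Fin 3 × Fin 2 × Fin (h' + 1))) ?_
    (Sum.elim (fun t => g t.1 t.2.1 t.2.2) (fun t => g' t.1 t.2.1 t.2.2)) ?_ ?_
  -- Two polynomials, three quadratic squares, two squares for each polynomial and h+1 from the
  -- integral: 12(h+1) ≤ 24h² since h ≥ 2.
  · simp only [Fintype.card_sum, Fintype.card_prod, Fintype.card_fin]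
    rw [h1]
    nlinarith
  · rintro (⟨i, j, k⟩ | ⟨i, j, k⟩)
    · exact isBoundedPolynomial_of_coeffNorm_le ((g1 i j k).trans (by omega)) (g2 i j k)
        (by rw [h1]; exact hexp)
    · exact isBoundedPolynomial_of_coeffNorm_le ((g1' i j k).trans (by omega)) (g2' i j k)
        (by rw [h1]; exact hexp)
  -- A polynomial over an infinite field is determined by its values, so the identity is checked
  -- pointwise, where the integrals make sense.
  · refine MvPolynomial.funext fun v => ?_
    rw [eval_sosTarget hU, map_sum, Fintype.sum_sum_type, intervalIntegral.integral_add]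
    · have key : ∀ (c : ℝ) (p : ℝ[X]) (f : Fin 2 → ℝ[X])
          (g : Fin 3 → Fin 2 → Fin (h' + 1) → MvPolynomial (Fin 2) ℝ)
          (_ : ∀ u, p.eval u = ∑ i, (f i).eval u ^ 2)
          (_ : ∀ i j (v : Fin 2 → ℝ), ∑ k, MvPolynomial.eval v (g i j k) ^ 2 =
            MvPolynomial.eval v (quadForm c i) ^ 2 *
              ∫ s in (0 : ℝ)..1, quadWeight i s * (f j).eval (v 0 + s * (v 1 - v 0)) ^ 2),
          ∫ s in (0 : ℝ)..1,
            (∑ i, MvPolynomial.eval v (quadForm c i) ^ 2 * quadWeight i s) *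
              p.eval (v 0 + s * (v 1 - v 0)) =
          ∑ t : Fin 3 × Fin 2 × Fin (h' + 1), MvPolynomial.eval v (g t.1 t.2.1 t.2.2) ^ 2 := by
        intro c p f g hp hg
        have hc := continuous_quadWeight
        have hI : ∀ i, ∑ j, MvPolynomial.eval v (quadForm c i) ^ 2 *
              ∫ s in (0 : ℝ)..1, quadWeight i s * (f j).eval (v 0 + s * (v 1 - v 0)) ^ 2 =
            ∫ s in (0 : ℝ)..1, ∑ j, MvPolynomial.eval v (quadForm c i) ^ 2 *
              (quadWeight i s * (f j).eval (v 0 + s * (v 1 - v 0)) ^ 2) := fun i => by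
          rw [intervalIntegral.integral_finsetSum
            (fun j _ => Continuous.intervalIntegrable (by fun_prop) _ _)]
          simp_rw [intervalIntegral.integral_const_mul]
        simp_rw [Fintype.sum_prod_type, hg, hI]
        rw [← intervalIntegral.integral_finsetSum
          (fun j _ => Continuous.intervalIntegrable (by fun_prop) _ _)]
        refine intervalIntegral.integral_congr fun s _ => ?_
        simp only [hp, Finset.sum_mul_sum]
        refine Finset.sum_congr rfl fun i _ => Finset.sum_congr rfl fun j _ => by ring
      rw [key _ _ f g h4 g3, key _ _ f' g' h4' g3']
      simp
    all_goals
      have hc := continuous_quadWeight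
      exact Continuous.intervalIntegrable (by fun_prop) _ _

end FlatExp

theorem mainTheorem3 :
    ∃ ε₀ : ℝ, 0 < ε₀ ∧ ∀ ε : ℝ, 0 < ε → ε < ε₀ → ∀ β : ℝ, 1 ≤ β →
      (∃ P : Polynomial ℝ, IsGoodFlatPolynomial β ε P) ∧
      ∀ P : Polynomial ℝ, IsGoodFlatPolynomial β ε P →
        ∀ U : Polynomial ℝ, Polynomial.derivative U = P →
          IsBoundedSOS (6 * P.natDegree ^ 2) P.natDegree
            (Real.exp (10 ^ 23 * β ^ 5 * Real.log (1 / ε) ^ 3)) (sosTarget P U) := by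
  -- This choice gives log(1/ε) ≥ 4, more than the 3 required, and ε < e^{-4} < 0.03, as the degree
  -- bound needs.
  refine ⟨Real.exp (-4), Real.exp_pos _, fun ε hε hε' β hβ => ?_⟩
  have hL : 4 ≤ Real.log (1 / ε) := by
    rw [one_div, Real.log_inv]
    have := (Real.log_lt_log hε hε').le
    rw [Real.log_exp] at this
    linarith
  have hε3 : ε ≤ 0.03 := by
    have h1 := Real.exp_neg_one_lt_d9
    have h2 : Real.exp (-4) = Real.exp (-1) ^ 4 := by rw [← Real.exp_nat_mul]; norm_num
    have h3 : Real.exp (-1) ^ 4 ≤ 0.4 ^ 4 :=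
      pow_le_pow_left₀ (Real.exp_pos _).le (by linarith) 4
    norm_num at h3 ⊢
    linarith
  exact ⟨FlatExp.exists_isGoodFlatPolynomial hβ hε (by linarith), fun P hP U hU =>
    FlatExp.isBoundedSOS_sosTarget hβ hε3 (by linarith) hP hU⟩
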